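/- **Setting.** A translation surface $(X,\mu)$ is a connected (Hausdorff, second countable) surface with an atlas of charts in $\mathbb{R}^2$ whose transition maps are (locally) translations. It carries the Riemannian distance $d_\mu$ of the pulled-back metric $dx^2+dy^2$. Let $\overline{X}$ be its metric completion and $\partial X=\overline{X}\setminus X$ its frontier; $X$ is precompact if $(X,d_\mu)$ is totally bounded. For $A\subset X$, $\partial A$ denotes the complement in the closure of $A$ in $\overline{X}$ of the interior of $A$. For a quadratic form $q$ on $\mathbb{R}^3$ let $U_q=\{x\in\mathbb{R}^2 : q(x_1,x_2,1)<0\}$. It is a nontrivial planar subconic if $\emptyset\neq U_q\neq\mathbb{R}^2$. The set $\mathcal{S}(\mathbb{R}^2)$ of nontrivial planar subconics is topologized by declaring a collection of subconics open iff the set of all quadratic forms defining its members is open among the forms that define nontrivial subconics. Let $\pi:\tilde X\to X$ be the universal covering, with the pulled-back translation structure, and let $\mathbf{dev}:\tilde X\to\mathbb{R}^2$ be a developing map (a map that near each point agrees with the charts up to translation), extended continuously to the completion of $\tilde X$. A subset of $\tilde X$ is convex if any two of its points are joined by a straight (geodesic) segment inside it. Let $\mathcal{S}(\tilde X)$ be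 the set of convex subsets $\tilde U\subset\tilde X$ for which $\mathbf{dev}(\tilde U)$ is a nontrivial planar subconic. Give it the coarsest topology such that $\tilde U\mapsto\mathbf{dev}(\tilde U)\in\mathcal{S}(\mathbb{R}^2)$ is continuous and, for each $x\in\tilde X$, the set $\{\tilde U : x\in\tilde U\}$ is open (so $\tilde U\mapsto\mathbf{dev}(\tilde U)$ is a local embedding). The space of subconics of $(X,\mu)$ is the quotient $\mathcal{S}(X,\mu)=\mathcal{S}(\tilde X)/\mathrm{Gal}(\tilde X/X)$ with the quotient topology, where $\mathrm{Gal}(\tilde X/X)$ is the group of covering transformations. A subset $A\subset\mathbb{R}^d$ has maximal span if there is $B\subset A$ such that the span of $\{b-b' : b,b'\in B\}$ has dimension at least $d$ or at least $\mathrm{Card}(A)-1$. Let $\mathcal{S}_n(X,\mu)\subset\mathcal{S}(X,\mu)$ be the set of orbits of those $\tilde U$ for which $\mathrm{Card}(\partial\tilde U\cap\partial\tilde X)\ge n$ and $\mathbf{dev}(\partial\tilde U\cap\partial\tilde X)$ has maximal span in $\mathbb{R}^2$. **Proposition.** Suppose that $(X,\mu)$ covers a precompact translation surface $(Y,\nu)$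 with nonempty finite frontier (that is, there is a covering $p:X\to Y$ with $\mu=p^*\nu$), and that the frontier of the universal cover $\tilde X$ is a discrete subset of the completion of $\tilde X$. Then $\mathcal{S}_5(X,\mu)$ is a discrete and countable subset of $\mathcal{S}(X,\mu)$. -/

import Mathlib

open Set Topology
open scoped Manifold ENNReal

noncomputable section

/-! ### Subconics in the plane -/

/-- The Euclidean plane `ℝ²`. -/
abbrev Plane : Type := EuclideanSpace ℝ (Fin 2)

/-- Quadratic forms on `ℝ³`. -/
abbrev Form3 : Type := QuadraticForm ℝ (Fin 3 → ℝ)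

/-- The natural topology of the six-dimensional vector space of quadratic forms on `ℝ³`,
given as the topology of pointwise convergence. -/
instance Form3.topology : TopologicalSpace Form3 :=
  TopologicalSpace.induced (fun (q : Form3) (v : Fin 3 → ℝ) => q v) inferInstance

/-- The point `(x₁, x₂, 1)` of `ℝ³`. -/
def hat (x : Plane) : Fin 3 → ℝ := ![x 0, x 1, 1]

/-- The planar subconic of a quadratic form `q`, the set of `x` with `q (x₁, x₂, 1) < 0`. -/
def conicSublevel (q : Form3) : Set Plane := {x | q (hat x) < 0}

/-- A planar subconic is nontrivial if it is neither empty nor the whole plane. -/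
def IsNontrivialForm (q : Form3) : Prop :=
  (conicSublevel q).Nonempty ∧ conicSublevel q ≠ univ

/-- The set of nontrivial subconics in the plane. -/
def PlanarSubconic : Type :=
  {U : Set Plane // ∃ q : Form3, IsNontrivialForm q ∧ U = conicSublevel q}

/-- The map that sends a quadratic form to its subconic. -/
def PlanarSubconic.ofForm (q : {q : Form3 // IsNontrivialForm q}) : PlanarSubconic :=
  ⟨conicSublevel q.1, q.1, q.2, rfl⟩

/-- A collection of nontrivial subconics is open if and only if the set of corresponding
quadratic forms is open (among the forms that define nontrivial subconics). -/
instance PlanarSubconic.topology : TopologicalSpace PlanarSubconic :=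
  TopologicalSpace.coinduced PlanarSubconic.ofForm inferInstance

/-- `A ⊆ ℝᵈ` has maximal span if, for some `B ⊆ A`, the span of the differences of elements of `B`
has dimension at least `d` or at least `Card A - 1`. -/
def HasMaximalSpan {d : ℕ} (A : Set (EuclideanSpace ℝ (Fin d))) : Prop :=
  ∃ B ⊆ A,
    d ≤ Module.finrank ℝ (Submodule.span ℝ {w | ∃ b ∈ B, ∃ b' ∈ B, w = b - b'}) ∨
    A.encard ≤
      (Module.finrank ℝ (Submodule.span ℝ {w | ∃ b ∈ B, ∃ b' ∈ B, w = b - b'}) : ℕ∞) + 1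

/-! ### Translation surfaces -/

/-- A translation surface: a connected Hausdorff second countable space with an atlas of
charts in the plane whose transition maps are locally translations. -/
class TranslationSurface (X : Type*) [TopologicalSpace X] [ChartedSpace Plane X] : Prop extends
    T2Space X, SecondCountableTopology X, ConnectedSpace X where
  transition_translation : ∀ e ∈ atlas Plane X, ∀ e' ∈ atlas Plane X,
    ∀ x ∈ e.source ∩ e'.source, ∃ v : Plane, ∀ᶠ y in 𝓝 x, e' y = e y + v

/-- A map of translation surfaces that is locally a translation in the charts. For a covering
map `f` this says that the translation structure of `X` is the pull-back under `f` of
that of `Y`. -/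
def IsTranslationMap {X Y : Type*} [TopologicalSpace X] [ChartedSpace Plane X]
    [TopologicalSpace Y] [ChartedSpace Plane Y] (f : X → Y) : Prop :=
  Continuous f ∧ ∀ e ∈ atlas Plane X, ∀ e' ∈ atlas Plane Y,
    ∀ x ∈ e.source, f x ∈ e'.source → ∃ v : Plane, ∀ᶠ y in 𝓝 x, e' (f y) = e y + v

/-- A developing map: a map to the plane that near each point agrees with every chart up to
a translation. -/
def IsDevelopingMap {X : Type*} [TopologicalSpace X] [ChartedSpace Plane X]
    (dev : X → Plane) : Prop :=
  ∀ e ∈ atlas Plane X, ∀ x ∈ e.source, ∃ v : Plane, ∀ᶠ y in 𝓝 x, dev y = e y + v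

section Metric

variable (X : Type*) [TopologicalSpace X] [ChartedSpace Plane X]

/-- A copy of `X` that carries the distance of the Riemannian metric `dx² + dy²`. -/
def FlatSpace : Type _ := X

/-- The norm on the tangent spaces that is pulled back from the plane by the charts.
The tangent space at `x` is identified with the plane by the preferred chart at `x`; on a
translation surface the norm so obtained does not depend on the chart. -/
@[reducible]
def flatTangentENorm (x : X) : ENorm (TangentSpace 𝓘(ℝ, Plane) x) :=
  inferInstanceAs (ENorm Plane)

/-- The Riemannian distance of the metric `dx² + dy²`, pulled back from the plane by the charts:
the infimum of the lengths of the `C¹` paths that join two points. -/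
def flatEDist (x y : X) : ℝ≥0∞ :=
  letI := flatTangentENorm X
  Manifold.riemannianEDist 𝓘(ℝ, Plane) x y

instance FlatSpace.pseudoEMetricSpace : PseudoEMetricSpace (FlatSpace X) where
  edist x y := flatEDist X x y
  edist_self x := by
    let := flatTangentENorm X
    have : ∀ z : X, ENormSMulClass ℝ (TangentSpace 𝓘(ℝ, Plane) z) :=
      fun _ => inferInstanceAs (ENormSMulClass ℝ Plane)
    exact Manifold.riemannianEDist_self (I := 𝓘(ℝ, Plane)) (M := X)
  edist_comm x y := by
    let := flatTangentENorm X
    have : ∀ z : X, ENormSMulClass ℝ (TangentSpace 𝓘(ℝ, Plane) z) :=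
      fun _ => inferInstanceAs (ENormSMulClass ℝ Plane)
    exact Manifold.riemannianEDist_comm (I := 𝓘(ℝ, Plane)) (M := X)
  edist_triangle x y z := by
    let := flatTangentENorm X
    have : ∀ z : X, ENormSMulClass ℝ (TangentSpace 𝓘(ℝ, Plane) z) :=
      fun _ => inferInstanceAs (ENormSMulClass ℝ Plane)
    exact Manifold.riemannianEDist_triangle (I := 𝓘(ℝ, Plane)) (M := X)

/-- The metric completion of a translation surface. -/
abbrev FlatCompletion : Type _ := UniformSpace.Completion (FlatSpace X)

/-- The canonical map from a translation surface to its metric completion. -/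
def toFlatCompletion (x : X) : FlatCompletion X :=
  UniformSpace.Completion.coe' (α := FlatSpace X) x

/-- The frontier of a translation surface: the points of the completion outside the surface. -/
def surfaceFrontier : Set (FlatCompletion X) := (range (toFlatCompletion X))ᶜ

/-- A translation surface is precompact if it is totally bounded for its distance. -/
def IsPrecompactSurface : Prop := TotallyBounded (univ : Set (FlatSpace X))

end Metric

section Subconics

variable {X : Type*} [TopologicalSpace X] [ChartedSpace Plane X]

/-- The continuous extension of a developing map to the metric completion. -/
def devExtension (dev : X → Plane) : FlatCompletion X → Plane :=
  UniformSpace.Completion.extension (α := FlatSpace X) dev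

/-- A path is a geodesic segment if, in charts, it is a straight segment that is traversed
with a constant velocity. -/
def IsGeodesicSegment {x y : X} (γ : Path x y) : Prop :=
  ∃ v : Plane, ∀ t : unitInterval, ∀ᶠ s in 𝓝 t,
    chartAt Plane (γ t) (γ s) = chartAt Plane (γ t) (γ t) + ((s : ℝ) - (t : ℝ)) • v

/-- A subset is convex if any two of its points are joined by a geodesic segment inside it. -/
def IsConvexSubset (U : Set X) : Prop :=
  ∀ x ∈ U, ∀ y ∈ U, ∃ γ : Path x y, IsGeodesicSegment γ ∧ ∀ t, γ t ∈ U

/-- Subconics in a simply connected translation surface with developing map `dev`: the convex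
subsets whose image under `dev` is a nontrivial planar subconic. -/
structure LiftedSubconic (dev : X → Plane) where
  carrier : Set X
  convex : IsConvexSubset carrier
  isSubconic : ∃ q : Form3, IsNontrivialForm q ∧ dev '' carrier = conicSublevel q

/-- The planar subconic onto which a subconic is developed. -/
def LiftedSubconic.develop {dev : X → Plane} (U : LiftedSubconic dev) : PlanarSubconic :=
  ⟨dev '' U.carrier, U.isSubconic⟩

/-- The topology on the space of subconics for which `U ↦ dev(U)` is a local embedding into
the space of planar subconics: the coarsest topology such that `U ↦ dev(U)` is continuous and,
for each point `x`, the set of subconics containing `x` is open. -/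
instance LiftedSubconic.topology (dev : X → Plane) : TopologicalSpace (LiftedSubconic dev) :=
  TopologicalSpace.induced LiftedSubconic.develop inferInstance ⊓
    TopologicalSpace.generateFrom (range fun x : X => {U : LiftedSubconic dev | x ∈ U.carrier})

/-- The points of the frontier of the surface that are met by a subconic. -/
def LiftedSubconic.conePoints {dev : X → Plane} (U : LiftedSubconic dev) :
    Set (FlatCompletion X) :=
  frontier (toFlatCompletion X '' U.carrier) ∩ surfaceFrontier X

/-- The orbit relation on subconics of the group of covering transformations of `π`. -/
def deckSetoid {Y : Type*} (π : X → Y) (dev : X → Plane) : Setoid (LiftedSubconic dev) where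
  r U V := ∃ φ : X ≃ₜ X, π ∘ φ = π ∧ φ '' U.carrier = V.carrier
  iseqv :=
    { refl := fun U => ⟨Homeomorph.refl X, rfl, by simp⟩
      symm := by
        rintro U V ⟨φ, hφ, h⟩
        refine ⟨φ.symm, ?_, ?_⟩
        · funext x
          have := congrFun hφ (φ.symm x)
          simpa using this.symm
        · rw [← h]
          simp [Set.image_image]
      trans := by
        rintro U V W ⟨φ, hφ, h⟩ ⟨ψ, hψ, h'⟩
        refine ⟨φ.trans ψ, ?_, ?_⟩
        · funext x
          have h1 := congrFun hψ (φ x)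
          have h2 := congrFun hφ x
          simp only [Function.comp_apply] at h1 h2
          simp [h1, h2]
        · rw [← h', ← h, Set.image_image]
          rfl }

/-- The space of subconics in a translation surface with universal cover `π`, with the
quotient topology. -/
abbrev SubconicSpace {Y : Type*} (π : X → Y) (dev : X → Plane) : Type _ :=
  Quotient (deckSetoid π dev)

/-- The `n`-stratum: the subconics that meet at least `n` points of the frontier of the universal
cover, such that the set of the developed images of these points has maximal span. -/
def subconicStratum {Y : Type*} (π : X → Y) (dev : X → Plane) (n : ℕ) :
    Set (SubconicSpace π dev) :=
  {u | ∃ U : LiftedSubconic dev, Quotient.mk (deckSetoid π dev) U = u ∧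
    (n : ℕ∞) ≤ U.conePoints.encard ∧ HasMaximalSpan (devExtension dev '' U.conePoints)}

end Subconics

end

/-! Call a subconic rich if it has at least five cone points whose developed images have maximal
span. The developing map is isometric on a convex set and on its closure in the completion
(`IsConvexSubset.dist_devExtension`), and convex sets with a common point agree over the
intersection of their images (`IsConvexSubset.mem_of_dev_mem`). Hence a frontier point in the
closure of one convex set cannot be developed into the open image of another convex set that meets
it (`IsConvexSubset.devExtension_notMem`). In particular the cone points of a subconic are developed
to zeros of its form, whose quadratic part is nonnegative by convexity.

Precompactness of the base enters only as recurrence (`exists_recurrence`): in any sequence of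
points of the universal cover, two become arbitrarily close after a covering transformation over the
base, which develops to a translation. Suppose the quadratic part of a rich subconic is degenerate.
Were the form to have a nonzero slope along the isotropic direction, as for a parabola, recurrence
along a sequence running to infinity would give a translate that meets the subconic and swallows a
cone point (`LiftedSubconic.slope_eq_zero`). So the subconic is a strip, and recurrence along its
centre line gives a transformation that preserves it (`exists_periodic_strip`). A rich subconic is
therefore an ellipse or a strip with a period.

In both cases, by compactness and discreteness of the frontier, some uniform neighbourhood of the
subconic contains no frontier points but its own cone points. Near an ellipse, a rich subconic has
its cone points among those of the ellipse, and five points determine the conic. Near a strip, a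
subconic avoids the periodic cone points on both boundary lines. If it is curved along the strip, an
estimate on slices (`quadPoly_near_strip`) puts its cone points on the two boundary lines, each of
which it meets at most twice: too few. Otherwise it is a strip, and equals the given one.

Thus rich subconics are isolated, and this passes to the quotient because the quotient map is open.
For countability, the frontier is countable, and a rich subconic is determined by one point of a
countable dense set together with five cone points (ellipse) or three (strip). -/

noncomputable section

/-! ### Translation maps and lengths of paths -/

section Lengths

open Manifold MeasureTheory

variable {M N : Type*} [TopologicalSpace M] [ChartedSpace Plane M]
  [TopologicalSpace N] [ChartedSpace Plane N]

theorem IsTranslationMap.eventually_chartAt {f : M → N} (hf : IsTranslationMap f) (x : M) :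
    ∃ v : Plane, ∀ᶠ y in 𝓝 x, chartAt Plane (f x) (f y) = chartAt Plane x y + v :=
  hf.2 _ (chart_mem_atlas _ _) _ (chart_mem_atlas _ _) x (mem_chart_source _ _)
    (mem_chart_source _ _)

/-- The path `γ` in the preferred chart at `γ t`. -/
def pathInChart (γ : ℝ → M) (t : ℝ) : ℝ → Plane := fun r => chartAt Plane (γ t) (γ r)

theorem contMDiffWithinAt_iff_pathInChart {γ : ℝ → M} {s : Set ℝ} {t : ℝ} :
    ContMDiffWithinAt 𝓘(ℝ, ℝ) 𝓘(ℝ, Plane) 1 γ s t ↔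
      ContinuousWithinAt γ s t ∧ ContDiffWithinAt ℝ 1 (pathInChart γ t) s t := by
  rw [contMDiffWithinAt_iff]
  simp only [mfld_simps, preimage_id, chartAt_self_eq]
  rfl

theorem mfderivWithin_eq_pathInChart {γ : ℝ → M} {s : Set ℝ} {t : ℝ}
    (hγ : ContMDiffWithinAt 𝓘(ℝ, ℝ) 𝓘(ℝ, Plane) 1 γ s t) :
    @Eq (ℝ →L[ℝ] Plane) (mfderivWithin 𝓘(ℝ, ℝ) 𝓘(ℝ, Plane) γ s t)
      (fderivWithin ℝ (pathInChart γ t) s t) := by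
  rw [mfderivWithin]
  refine (if_pos (hγ.mdifferentiableWithinAt one_ne_zero)).trans ?_
  simp only [mfld_simps, preimage_id, chartAt_self_eq]
  rfl

/-- In charts `f` adds a constant, so smoothness, velocity and length of paths are unaffected. The
value at `t` is recorded separately because `t` need not belong to `s`. -/
theorem IsTranslationMap.pathInChart_comp {f : M → N} (hf : IsTranslationMap f) {γ : ℝ → M}
    {s : Set ℝ} {t : ℝ} (hγ : ContinuousWithinAt γ s t) :
    ∃ v : Plane, pathInChart (f ∘ γ) t =ᶠ[𝓝[s] t] (fun r => pathInChart γ t r + v) ∧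
      pathInChart (f ∘ γ) t t = pathInChart γ t t + v := by
  obtain ⟨v, hv⟩ := hf.eventually_chartAt (γ t)
  exact ⟨v, hγ.eventually hv, hv.self_of_nhds⟩

theorem IsTranslationMap.contMDiffWithinAt_comp_iff {f : M → N} (hf : IsTranslationMap f)
    {γ : ℝ → M} {s : Set ℝ} {t : ℝ} (hγ : ContinuousWithinAt γ s t) :
    ContMDiffWithinAt 𝓘(ℝ, ℝ) 𝓘(ℝ, Plane) 1 (f ∘ γ) s t ↔
      ContMDiffWithinAt 𝓘(ℝ, ℝ) 𝓘(ℝ, Plane) 1 γ s t := by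
  obtain ⟨v, hv, hv'⟩ := hf.pathInChart_comp hγ
  have hc : ContinuousWithinAt (f ∘ γ) s t := hf.1.continuousAt.comp_continuousWithinAt hγ
  rw [contMDiffWithinAt_iff_pathInChart, contMDiffWithinAt_iff_pathInChart]
  simp only [hγ, hc, true_and]
  constructor
  · intro h
    have := (h.congr_of_eventuallyEq hv.symm hv'.symm).sub (contDiffWithinAt_const (c := v))
    simpa using this
  · intro h
    exact (h.add (contDiffWithinAt_const (c := v))).congr_of_eventuallyEq hv hv'

theorem IsTranslationMap.mfderivWithin_comp {f : M → N} (hf : IsTranslationMap f)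
    {γ : ℝ → M} {s : Set ℝ} {t : ℝ} (hγ : ContMDiffWithinAt 𝓘(ℝ, ℝ) 𝓘(ℝ, Plane) 1 γ s t) :
    @Eq (ℝ →L[ℝ] Plane) (mfderivWithin 𝓘(ℝ, ℝ) 𝓘(ℝ, Plane) (f ∘ γ) s t)
      (mfderivWithin 𝓘(ℝ, ℝ) 𝓘(ℝ, Plane) γ s t) := by
  obtain ⟨v, hv, hv'⟩ := hf.pathInChart_comp hγ.continuousWithinAt
  rw [mfderivWithin_eq_pathInChart hγ, mfderivWithin_eq_pathInChart
    ((hf.contMDiffWithinAt_comp_iff hγ.continuousWithinAt).2 hγ), hv.fderivWithin_eq hv']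
  exact fderivWithin_add_const _

attribute [local instance] flatTangentENorm

theorem IsTranslationMap.pathELength_comp {f : M → N} (hf : IsTranslationMap f)
    {γ : ℝ → M} {a b : ℝ} (hγ : ContMDiffOn 𝓘(ℝ, ℝ) 𝓘(ℝ, Plane) 1 γ (Icc a b)) :
    pathELength 𝓘(ℝ, Plane) (f ∘ γ) a b = pathELength 𝓘(ℝ, Plane) γ a b := by
  rw [pathELength_eq_lintegral_mfderivWithin_Icc, pathELength_eq_lintegral_mfderivWithin_Icc]
  refine setLIntegral_congr_fun measurableSet_Icc fun t ht => ?_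
  have := hf.mfderivWithin_comp (hγ t ht)
  exact congrArg (fun A : ℝ →L[ℝ] Plane => ‖A 1‖ₑ) this

instance flatTangent_enormSMulClass (x : M) :
    ENormSMulClass ℝ (TangentSpace 𝓘(ℝ, Plane) x) :=
  inferInstanceAs (ENormSMulClass ℝ Plane)

theorem flatEDist_le_pathELength {γ : ℝ → M} {x y : M} {a b : ℝ}
    (hγ : ContMDiffOn 𝓘(ℝ, ℝ) 𝓘(ℝ, Plane) 1 γ (Icc a b))
    (ha : γ a = x) (hb : γ b = y) (hab : a ≤ b) :
    flatEDist M x y ≤ pathELength 𝓘(ℝ, Plane) γ a b :=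
  riemannianEDist_le_pathELength hγ ha hb hab

theorem exists_path_of_flatEDist_lt {x y : M} {r : ℝ≥0∞} (h : flatEDist M x y < r) :
    ∃ γ : ℝ → M, γ 0 = x ∧ γ 1 = y ∧ ContMDiffOn 𝓘(ℝ, ℝ) 𝓘(ℝ, Plane) 1 γ (Icc 0 1) ∧
      pathELength 𝓘(ℝ, Plane) γ 0 1 < r :=
  exists_lt_of_riemannianEDist_lt h

/-- A continuous path whose image under a translation map is of class `C¹` is not shorter than
the distance of its ends. -/
theorem IsTranslationMap.flatEDist_le_pathELength_comp {f : M → N} (hf : IsTranslationMap f)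
    {γ : ℝ → M} {x y : M} (hc : ContinuousOn γ (Icc 0 1))
    (hγ : ContMDiffOn 𝓘(ℝ, ℝ) 𝓘(ℝ, Plane) 1 (f ∘ γ) (Icc 0 1))
    (h0 : γ 0 = x) (h1 : γ 1 = y) :
    flatEDist M x y ≤ pathELength 𝓘(ℝ, Plane) (f ∘ γ) 0 1 := by
  have hγ' : ContMDiffOn 𝓘(ℝ, ℝ) 𝓘(ℝ, Plane) 1 γ (Icc 0 1) := fun t ht =>
    (hf.contMDiffWithinAt_comp_iff (hc t ht)).1 (hγ t ht)
  rw [hf.pathELength_comp hγ']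
  exact flatEDist_le_pathELength hγ' h0 h1 zero_le_one

theorem IsTranslationMap.flatEDist_le {f : M → N} (hf : IsTranslationMap f) (x y : M) :
    flatEDist N (f x) (f y) ≤ flatEDist M x y := by
  refine le_of_forall_gt fun r hr => ?_
  obtain ⟨γ, h0, h1, hγ, hl⟩ := exists_path_of_flatEDist_lt hr
  refine lt_of_le_of_lt ?_ hl
  rw [← hf.pathELength_comp hγ]
  exact flatEDist_le_pathELength
    (fun t ht => (hf.contMDiffWithinAt_comp_iff (hγ t ht).continuousWithinAt).2 (hγ t ht))
    (by simp [h0]) (by simp [h1]) zero_le_one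

theorem edist_le_flatEDist_plane (x y : Plane) : edist x y ≤ flatEDist Plane x y := by
  refine le_of_forall_gt fun r hr => ?_
  obtain ⟨γ, h0, h1, hγ, hl⟩ := exists_path_of_flatEDist_lt hr
  refine lt_of_le_of_lt ?_ hl
  have D : ContDiffOn ℝ 1 γ (Icc 0 1) := contMDiffOn_iff_contDiffOn.mp hγ
  rw [pathELength_eq_lintegral_mfderivWithin_Icc, edist_comm, edist_eq_enorm_sub, ← h0, ← h1]
  refine (enorm_sub_le_lintegral_derivWithin_Icc_of_contDiffOn_Icc D zero_le_one).trans_eq ?_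
  simp only [mfderivWithin_eq_fderivWithin]
  rfl

/-- The distance of the ends of a geodesic segment is at most its speed. -/
theorem IsGeodesicSegment.flatEDist_le {x y : M} {γ : Path x y} {v : Plane}
    (hγ : ∀ t : unitInterval, ∀ᶠ s in 𝓝 t,
      chartAt Plane (γ t) (γ s) = chartAt Plane (γ t) (γ t) + ((s : ℝ) - (t : ℝ)) • v) :
    flatEDist M x y ≤ ‖v‖ₑ := by
  set η : ℝ → M := fun s => γ.extend s with hη
  have hcont : Continuous η := γ.extend.continuous
  have key : ∀ t ∈ Icc (0 : ℝ) 1,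
      pathInChart η t =ᶠ[𝓝[Icc 0 1] t]
        fun s => chartAt Plane (η t) (η t) + (s - t) • v := by
    intro t ht
    have h1 := hγ ⟨t, ht⟩
    have h2 : ∀ᶠ s in 𝓝[Icc 0 1] t, chartAt Plane (γ ⟨t, ht⟩) (γ (projIcc 0 1 zero_le_one s)) =
        chartAt Plane (γ ⟨t, ht⟩) (γ ⟨t, ht⟩) + ((projIcc 0 1 zero_le_one s : ℝ) - t) • v := by
      have hp : Filter.Tendsto (projIcc (0 : ℝ) 1 zero_le_one) (𝓝[Icc 0 1] t) (𝓝 ⟨t, ht⟩) := by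
        have := (continuous_projIcc (h := zero_le_one (α := ℝ))).tendsto t
        rw [projIcc_of_mem zero_le_one ht] at this
        exact this.mono_left nhdsWithin_le_nhds
      exact hp.eventually h1
    filter_upwards [h2, self_mem_nhdsWithin] with s hs hs'
    rw [projIcc_of_mem zero_le_one hs'] at hs
    simpa [pathInChart, hη, Path.extend_apply _ ht, Path.extend_apply _ hs'] using hs
  have hd : ∀ t ∈ Icc (0 : ℝ) 1, HasFDerivWithinAt
      (fun s : ℝ => chartAt Plane (η t) (η t) + (s - t) • v)
      (ContinuousLinearMap.toSpanSingleton ℝ v) (Icc 0 1) t := by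
    intro t _
    have : HasDerivAt (fun s : ℝ => chartAt Plane (η t) (η t) + (s - t) • v) ((1 : ℝ) • v) t :=
      (((hasDerivAt_id t).sub_const t).smul_const v).const_add _
    rw [one_smul] at this
    exact this.hasFDerivAt.hasFDerivWithinAt
  have hC : ContMDiffOn 𝓘(ℝ, ℝ) 𝓘(ℝ, Plane) 1 η (Icc 0 1) := by
    intro t ht
    refine contMDiffWithinAt_iff_pathInChart.2 ⟨hcont.continuousWithinAt, ?_⟩
    refine ContDiffWithinAt.congr_of_eventuallyEq_of_mem ?_ (key t ht) ht
    exact ContDiff.contDiffWithinAt (by fun_prop)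
  have hD : ∀ t ∈ Icc (0 : ℝ) 1, @DFunLike.coe (ℝ →L[ℝ] Plane) _ _ _
      (mfderivWithin 𝓘(ℝ, ℝ) 𝓘(ℝ, Plane) η (Icc 0 1) t) 1 = v := by
    intro t ht
    rw [mfderivWithin_eq_pathInChart (hC t ht)]
    rw [(key t ht).fderivWithin_eq_of_mem ht, (hd t ht).fderivWithin (uniqueDiffOn_Icc zero_lt_one t ht)]
    simp
  refine (flatEDist_le_pathELength hC (by simp [hη]) (by simp [hη]) zero_le_one).trans ?_
  rw [pathELength_eq_lintegral_mfderivWithin_Icc]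
  refine (setLIntegral_congr_fun (g := fun _ => ‖v‖ₑ) measurableSet_Icc fun t ht =>
    congrArg (fun w : Plane => ‖w‖ₑ) (hD t ht)).le.trans ?_
  simp

end Lengths

/-! ### Charts, the flat distance and developing maps -/

section Surfaces

variable {X : Type*} [TopologicalSpace X] [ChartedSpace Plane X]

/-- Straight segments in a ball of the preferred chart at `x` remain straight in every other
preferred chart, since transition maps are translations. -/
theorem exists_convex_chart_nhds [TranslationSurface X] (x : X) {N : Set X} (hN : N ∈ 𝓝 x) :
    ∃ r > 0, Metric.ball (chartAt Plane x x) r ⊆ (chartAt Plane x).target ∧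
      (chartAt Plane x).symm '' Metric.ball (chartAt Plane x x) r ⊆ N ∧
      IsOpen ((chartAt Plane x).symm '' Metric.ball (chartAt Plane x x) r) ∧
      IsConvexSubset ((chartAt Plane x).symm '' Metric.ball (chartAt Plane x x) r) := by
  set e := chartAt Plane x with he
  have hx : x ∈ e.source := mem_chart_source _ _
  have hN' : e.symm ⁻¹' N ∈ 𝓝 (e x) :=
    (e.continuousAt_symm (e.map_source hx)).preimage_mem_nhds (by rwa [e.left_inv hx])
  obtain ⟨r, hr, hrs⟩ := Metric.mem_nhds_iff.1
    (Filter.inter_mem hN' (e.open_target.mem_nhds (e.map_source hx)))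
  have hrt : Metric.ball (e x) r ⊆ e.target := fun p hp => (hrs hp).2
  refine ⟨r, hr, hrt, image_subset_iff.2 fun p hp => (hrs hp).1,
    e.symm.isOpen_image_of_subset_source Metric.isOpen_ball hrt, ?_⟩
  rintro _ ⟨p, hp, rfl⟩ _ ⟨q, hq, rfl⟩
  have hmem : ∀ t : unitInterval, p + (t : ℝ) • (q - p) ∈ Metric.ball (e x) r := fun t =>
    (convex_ball (e x) r).add_smul_sub_mem hp hq t.2
  have hcont : Continuous fun t : unitInterval => e.symm (p + (t : ℝ) • (q - p)) :=
    e.continuousOn_symm.comp_continuous (by fun_prop) fun t => hrt (hmem t)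
  refine ⟨⟨⟨fun t : unitInterval => e.symm (p + (t : ℝ) • (q - p)), hcont⟩, by simp, by simp⟩,
    ⟨q - p, fun t => ?_⟩, fun t => ⟨_, hmem t, rfl⟩⟩
  simp only [Path.coe_mk', ContinuousMap.coe_mk]
  set y := e.symm (p + (t : ℝ) • (q - p)) with hy
  have hye : y ∈ e.source := e.map_target (hrt (hmem t))
  obtain ⟨v, hv⟩ := TranslationSurface.transition_translation (X := X) e (chart_mem_atlas _ _)
    (chartAt Plane y) (chart_mem_atlas _ _) y ⟨hye, mem_chart_source _ _⟩
  have hev := (hcont.continuousAt (x := t)).eventually hv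
  filter_upwards [hev] with s hs
  rw [hs, hv.self_of_nhds, hy, e.right_inv (hrt (hmem s)), e.right_inv (hrt (hmem t))]
  module

theorem IsConvexSubset.flatEDist_lt_top {U : Set X} (hU : IsConvexSubset U) {x y : X}
    (hx : x ∈ U) (hy : y ∈ U) : flatEDist X x y < ⊤ := by
  obtain ⟨γ, ⟨v, hv⟩, -⟩ := hU x hx y hy
  exact (IsGeodesicSegment.flatEDist_le hv).trans_lt enorm_lt_top

theorem flatEDist_comm (x y : X) : flatEDist X x y = flatEDist X y x :=
  edist_comm (α := FlatSpace X) x y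

theorem flatEDist_triangle (x y z : X) :
    flatEDist X x z ≤ flatEDist X x y + flatEDist X y z :=
  edist_triangle (α := FlatSpace X) x y z

theorem flatEDist_self (x : X) : flatEDist X x x = 0 :=
  edist_self (α := FlatSpace X) x

/-- Points joined by a geodesic segment are at finite distance, so the points at finite distance
from `x` form a clopen set, and the surface is connected. -/
theorem flatEDist_lt_top [TranslationSurface X] (x y : X) : flatEDist X x y < ⊤ := by
  have key : ∀ z : X, ∃ W : Set X, IsOpen W ∧ z ∈ W ∧ ∀ w ∈ W, flatEDist X z w < ⊤ := by
    intro z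
    obtain ⟨r, hr, -, -, ho, hc⟩ := exists_convex_chart_nhds z Filter.univ_mem
    have hz : z ∈ (chartAt Plane z).symm '' Metric.ball (chartAt Plane z z) r :=
      ⟨_, Metric.mem_ball_self hr, (chartAt Plane z).left_inv (mem_chart_source _ _)⟩
    exact ⟨_, ho, hz, fun w hw => hc.flatEDist_lt_top hz hw⟩
  have hclopen : IsClopen {z : X | flatEDist X x z < ⊤} := by
    constructor
    · rw [← isOpen_compl_iff, isOpen_iff_mem_nhds]
      intro z hz
      obtain ⟨W, hWo, hzW, hW⟩ := key z
      filter_upwards [hWo.mem_nhds hzW] with w hw hxw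
      exact hz ((flatEDist_triangle x w z).trans_lt
        (ENNReal.add_lt_top.2 ⟨hxw, flatEDist_comm z w ▸ hW w hw⟩))
    · rw [isOpen_iff_mem_nhds]
      intro z hz
      obtain ⟨W, hWo, hzW, hW⟩ := key z
      filter_upwards [hWo.mem_nhds hzW] with w hw
      exact (flatEDist_triangle x z w).trans_lt (ENNReal.add_lt_top.2 ⟨hz, hW w hw⟩)
  have huniv := hclopen.eq_univ ⟨x, by simp [flatEDist_self]⟩
  exact huniv.symm.subset (mem_univ y)

/-- The flat distance of a (connected) translation surface is finite. -/
instance FlatSpace.pseudoMetricSpace [TranslationSurface X] : PseudoMetricSpace (FlatSpace X) :=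
  PseudoEMetricSpace.toPseudoMetricSpace fun x y => (flatEDist_lt_top (X := X) x y).ne

/-- The flat distance as a real number. -/
def flatDist [TranslationSurface X] (x y : X) : ℝ := dist (α := FlatSpace X) x y

theorem flatEDist_eq_ofReal [TranslationSurface X] (x y : X) :
    flatEDist X x y = ENNReal.ofReal (flatDist x y) :=
  edist_dist (α := FlatSpace X) x y

theorem dist_toFlatCompletion [TranslationSurface X] (x y : X) :
    dist (toFlatCompletion X x) (toFlatCompletion X y) = flatDist x y :=
  UniformSpace.Completion.dist_eq (α := FlatSpace X) x y

variable {dev : X → Plane}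

theorem IsDevelopingMap.eventually_eq (hdev : IsDevelopingMap dev) (x : X) :
    ∃ v : Plane, ∀ᶠ y in 𝓝 x, dev y = chartAt Plane x y + v :=
  hdev _ (chart_mem_atlas _ _) x (mem_chart_source _ _)

theorem IsDevelopingMap.continuous (hdev : IsDevelopingMap dev) : Continuous dev := by
  rw [continuous_iff_continuousAt]
  intro x
  obtain ⟨v, hv⟩ := hdev.eventually_eq x
  exact (((chartAt Plane x).continuousAt (mem_chart_source _ _)).add continuousAt_const).congr
    (Filter.EventuallyEq.symm hv)

theorem IsDevelopingMap.isTranslationMap (hdev : IsDevelopingMap dev) : IsTranslationMap dev := by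
  refine ⟨hdev.continuous, fun e he e' he' x hx _ => ?_⟩
  rw [chartedSpaceSelf_atlas] at he'
  subst he'
  exact hdev e he x hx

theorem IsDevelopingMap.edist_le (hdev : IsDevelopingMap dev) (x y : X) :
    edist (dev x) (dev y) ≤ flatEDist X x y :=
  (edist_le_flatEDist_plane _ _).trans (hdev.isTranslationMap.flatEDist_le x y)

theorem IsDevelopingMap.dist_le [TranslationSurface X] (hdev : IsDevelopingMap dev) (x y : X) :
    dist (dev x) (dev y) ≤ flatDist x y := by
  have h := hdev.edist_le x y
  rw [flatEDist_eq_ofReal, edist_dist] at h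
  exact (ENNReal.ofReal_le_ofReal_iff dist_nonneg).1 h

theorem IsDevelopingMap.isLocallyInjective (hdev : IsDevelopingMap dev) :
    IsLocallyInjective dev := by
  rw [isLocallyInjective_iff_nhds]
  intro x
  obtain ⟨v, hv⟩ := hdev.eventually_eq x
  refine ⟨_, Filter.inter_mem hv ((chartAt Plane x).open_source.mem_nhds (mem_chart_source _ _)),
    fun y hy z hz h => ?_⟩
  rw [hy.1, hz.1] at h
  exact (chartAt Plane x).injOn hy.2 hz.2 (add_right_cancel h)

/-- For a segment of velocity `v`, the function `dev (γ s) - s • v` is locally constant on the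
interval, hence constant. This turns the chartwise definition into one global equation. -/
theorem IsDevelopingMap.isGeodesicSegment_iff (hdev : IsDevelopingMap dev) {x y : X}
    {γ : Path x y} :
    IsGeodesicSegment γ ↔ ∀ s, dev (γ s) = dev x + (s : ℝ) • (dev y - dev x) := by
  constructor
  · rintro ⟨v, hv⟩
    have hloc : IsLocallyConstant fun s : unitInterval => dev (γ s) - (s : ℝ) • v := by
      rw [IsLocallyConstant.iff_eventually_eq]
      intro t
      obtain ⟨c, hc⟩ := hdev.eventually_eq (γ t)
      filter_upwards [hv t, (γ.continuous.continuousAt (x := t)).eventually hc] with s hs hs'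
      rw [hs', hc.self_of_nhds, hs]
      module
    have h0 : ∀ s, dev (γ s) = dev x + (s : ℝ) • v := by
      intro s
      have := hloc.apply_eq_of_isPreconnected isPreconnected_univ (mem_univ s) (mem_univ 0)
      simp only [Path.source, Icc.coe_zero, zero_smul, sub_zero] at this
      rw [← this]
      module
    have h1 := h0 1
    simp only [Path.target, Icc.coe_one, one_smul] at h1
    intro s
    rw [h0 s, h1]
    module
  · intro h
    refine ⟨dev y - dev x, fun t => ?_⟩
    obtain ⟨c, hc⟩ := hdev.eventually_eq (γ t)
    filter_upwards [(γ.continuous.continuousAt (x := t)).eventually hc] with s hs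
    have h1 := hc.self_of_nhds
    rw [h s] at hs
    rw [h t] at h1
    rw [← sub_eq_iff_eq_add] at hs h1
    rw [← hs, ← h1]
    module

/-- One inequality is the length of the segment, the other is that `dev` does not increase
distances. -/
theorem IsDevelopingMap.edist_eq_of_geodesic (hdev : IsDevelopingMap dev) {x y : X}
    {γ : Path x y} (hγ : IsGeodesicSegment γ) : flatEDist X x y = edist (dev x) (dev y) := by
  refine le_antisymm ?_ (hdev.edist_le x y)
  have h := hdev.isGeodesicSegment_iff.1 hγ
  rw [edist_comm, edist_eq_enorm_sub]
  refine IsGeodesicSegment.flatEDist_le (γ := γ) fun t => ?_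
  obtain ⟨c, hc⟩ := hdev.eventually_eq (γ t)
  filter_upwards [(γ.continuous.continuousAt (x := t)).eventually hc] with s hs
  have h1 := hc.self_of_nhds
  rw [h s] at hs
  rw [h t] at h1
  rw [← sub_eq_iff_eq_add] at hs h1
  rw [← hs, ← h1]
  module

/-- A small convex neighbourhood on which the developing map is injective onto a ball. -/
theorem IsDevelopingMap.exists_ball_sheet [TranslationSurface X] (hdev : IsDevelopingMap dev)
    (x : X) : ∃ r > 0, ∃ W : Set X, IsOpen W ∧ x ∈ W ∧ IsConvexSubset W ∧
      dev '' W = Metric.ball (dev x) r := by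
  obtain ⟨v, hv⟩ := hdev.eventually_eq x
  obtain ⟨r, hr, hrt, hN, ho, hc⟩ := exists_convex_chart_nhds x hv
  have hx : x ∈ (chartAt Plane x).symm '' Metric.ball (chartAt Plane x x) r :=
    ⟨_, Metric.mem_ball_self hr, (chartAt Plane x).left_inv (mem_chart_source _ _)⟩
  refine ⟨r, hr, _, ho, hx, hc, ?_⟩
  have hxv : dev x = chartAt Plane x x + v := hN hx
  have himg : ∀ p ∈ Metric.ball (chartAt Plane x x) r, dev ((chartAt Plane x).symm p) = p + v := by
    intro p hp
    have : dev ((chartAt Plane x).symm p) = chartAt Plane x ((chartAt Plane x).symm p) + v :=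
      hN ⟨p, hp, rfl⟩
    rw [this, (chartAt Plane x).right_inv (hrt hp)]
  ext p
  rw [image_image]
  constructor
  · rintro ⟨q, hq, rfl⟩
    change dev _ ∈ _
    rw [himg q hq, hxv]
    simpa using hq
  · intro hp
    have hq : p - v ∈ Metric.ball (chartAt Plane x x) r := by
      rw [hxv] at hp
      simpa [dist_eq_norm, sub_sub, add_comm] using hp
    exact ⟨p - v, hq, (himg _ hq).trans (by simp)⟩

end Surfaces

/-! ### Convex subsets and the metric completion -/

section Convex

attribute [local instance] flatTangentENorm

variable {X : Type*} [TopologicalSpace X] [ChartedSpace Plane X] [TranslationSurface X]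
  {dev : X → Plane} {U V : Set X}

theorem IsConvexSubset.exists_path (hU : IsConvexSubset U) (hdev : IsDevelopingMap dev) {x y : X}
    (hx : x ∈ U) (hy : y ∈ U) : ∃ γ : Path x y,
      (∀ s, dev (γ s) = dev x + (s : ℝ) • (dev y - dev x)) ∧ ∀ t, γ t ∈ U := by
  obtain ⟨γ, hγ, h⟩ := hU x hx y hy
  exact ⟨γ, hdev.isGeodesicSegment_iff.1 hγ, h⟩

theorem IsConvexSubset.convex_image (hU : IsConvexSubset U) (hdev : IsDevelopingMap dev) :
    Convex ℝ (dev '' U) := by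
  rw [convex_iff_segment_subset]
  rintro _ ⟨x, hx, rfl⟩ _ ⟨y, hy, rfl⟩
  obtain ⟨γ, hγ, h⟩ := hU.exists_path hdev hx hy
  rw [segment_eq_image']
  rintro _ ⟨t, ht, rfl⟩
  exact ⟨γ ⟨t, ht⟩, h _, hγ ⟨t, ht⟩⟩

theorem IsConvexSubset.flatDist_eq (hU : IsConvexSubset U) (hdev : IsDevelopingMap dev) {x y : X}
    (hx : x ∈ U) (hy : y ∈ U) : flatDist x y = dist (dev x) (dev y) := by
  obtain ⟨γ, hγ, -⟩ := hU x hx y hy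
  have h := hdev.edist_eq_of_geodesic hγ
  rw [flatEDist_eq_ofReal, edist_dist] at h
  exact (ENNReal.ofReal_eq_ofReal_iff dist_nonneg dist_nonneg).1 h

/-- Two convex sets with a common point agree over the intersection of their images. -/
theorem IsConvexSubset.mem_of_dev_mem (hU : IsConvexSubset U) (hV : IsConvexSubset V)
    (hdev : IsDevelopingMap dev) {a u : X} (haU : a ∈ U) (haV : a ∈ V) (hu : u ∈ U)
    (h : dev u ∈ dev '' V) : u ∈ V := by
  obtain ⟨v, hv, hvu⟩ := h
  obtain ⟨γ, hγ, -⟩ := hU.exists_path hdev haU hu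
  obtain ⟨η, hη, -⟩ := hV.exists_path hdev haV hv
  -- Both segments start at `a` and have the same development. Lifts through a locally injective map
  -- to a Hausdorff source are unique, so the segments coincide.
  have heq : (γ : unitInterval → X) = η :=
    (T2Space.isSeparatedMap dev).eq_of_comp_eq hdev.isLocallyInjective γ.continuous η.continuous
      (by funext s; simp [hγ, hη, hvu]) 0 (by simp)
  have : u = v := by simpa using congrFun heq 1
  exact this ▸ hv

theorem IsConvexSubset.eq_of_image_eq (hU : IsConvexSubset U) (hV : IsConvexSubset V)
    (hdev : IsDevelopingMap dev) {a : X} (haU : a ∈ U) (haV : a ∈ V)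
    (h : dev '' U = dev '' V) : U = V :=
  Subset.antisymm
    (fun _ hu => hU.mem_of_dev_mem hV hdev haU haV hu (h ▸ mem_image_of_mem _ hu))
    (fun _ hv => hV.mem_of_dev_mem hU hdev haV haU hv (h ▸ mem_image_of_mem _ hv))

theorem IsConvexSubset.isOpen (hU : IsConvexSubset U) (hdev : IsDevelopingMap dev)
    (ho : IsOpen (dev '' U)) : IsOpen U := by
  rw [isOpen_iff_mem_nhds]
  intro x hx
  obtain ⟨r, hr, W, hWo, hxW, hW, -⟩ := hdev.exists_ball_sheet x
  filter_upwards [hWo.mem_nhds hxW,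
    (ho.preimage hdev.continuous).mem_nhds (mem_image_of_mem dev hx)] with y hy hy'
  exact hW.mem_of_dev_mem hU hdev hxW hx hy hy'

/-- A path from `u` shorter than `ε` is developed inside the ball, hence inside `dev '' U`. It
cannot leave `U`: at a limit point of `U` on the path, a small convex sheet meets `U` and agrees
with it over the common image. Recurrence uses this to turn closeness into an actual intersection.
-/
theorem IsConvexSubset.mem_of_flatDist_lt (hU : IsConvexSubset U) (hdev : IsDevelopingMap dev)
    (ho : IsOpen (dev '' U)) {u x : X} (hu : u ∈ U) {ε : ℝ}
    (hε : Metric.ball (dev u) ε ⊆ dev '' U) (hx : flatDist u x < ε) : x ∈ U := by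
  have hlt : flatEDist X u x < ENNReal.ofReal ε := by
    rw [flatEDist_eq_ofReal]
    exact (ENNReal.ofReal_lt_ofReal_iff (dist_nonneg.trans_lt hx)).2 hx
  obtain ⟨γ, h0, h1, hγ, hl⟩ := exists_path_of_flatEDist_lt hlt
  have hball : ∀ t ∈ Icc (0 : ℝ) 1, dev (γ t) ∈ Metric.ball (dev u) ε := by
    intro t ht
    have h : flatEDist X u (γ t) < ENNReal.ofReal ε :=
      ((flatEDist_le_pathELength (hγ.mono (Icc_subset_Icc_right ht.2)) h0 rfl ht.1).trans
        (Manifold.pathELength_mono le_rfl ht.2)).trans_lt hl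
    have h' := (hdev.edist_le u (γ t)).trans_lt h
    rw [edist_dist, ENNReal.ofReal_lt_ofReal_iff (dist_nonneg.trans_lt hx)] at h'
    rwa [Metric.mem_ball, dist_comm]
  have hsub : γ '' Icc (0 : ℝ) 1 ⊆ U := by
    refine (isPreconnected_Icc.image _ hγ.continuousOn).subset_of_closure_inter_subset
      (hU.isOpen hdev ho) ⟨u, ⟨0, by simp, h0⟩, hu⟩ ?_
    rintro _ ⟨hcl, ⟨t, ht, rfl⟩⟩
    obtain ⟨r, hr, W, hWo, hxW, hW, -⟩ := hdev.exists_ball_sheet (γ t)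
    obtain ⟨a, haW, haU⟩ := mem_closure_iff.1 hcl W hWo hxW
    exact hW.mem_of_dev_mem hU hdev haW haU hxW (hε (hball t ht))
  exact hsub ⟨1, by simp, h1⟩

/-- The completion only knows the flat distance; the comparison with the topology of the surface
comes from `dev`, which is continuous and isometric on small convex sheets. -/
theorem IsDevelopingMap.continuous_toFlatCompletion (hdev : IsDevelopingMap dev) :
    Continuous (toFlatCompletion X) := by
  rw [continuous_iff_continuousAt]
  intro x
  obtain ⟨r, hr, W, hWo, hxW, hW, -⟩ := hdev.exists_ball_sheet x
  rw [ContinuousAt, tendsto_iff_dist_tendsto_zero]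
  have h : Filter.Tendsto (fun y => dist (dev y) (dev x)) (𝓝 x) (𝓝 0) :=
    tendsto_iff_dist_tendsto_zero.1 hdev.continuous.continuousAt
  refine h.congr' ?_
  filter_upwards [hWo.mem_nhds hxW] with y hy
  rw [dist_toFlatCompletion, hW.flatDist_eq hdev hy hxW]

theorem denseRange_toFlatCompletion : DenseRange (toFlatCompletion X) :=
  UniformSpace.Completion.denseRange_coe (α := FlatSpace X)

theorem IsDevelopingMap.separableSpace_flatCompletion (hdev : IsDevelopingMap dev) :
    TopologicalSpace.SeparableSpace (FlatCompletion X) :=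
  denseRange_toFlatCompletion.separableSpace hdev.continuous_toFlatCompletion

theorem IsDevelopingMap.lipschitzWith (hdev : IsDevelopingMap dev) :
    LipschitzWith (α := FlatSpace X) 1 dev :=
  LipschitzWith.of_dist_le_mul (α := FlatSpace X) fun x y => by
    rw [NNReal.coe_one, one_mul]
    exact hdev.dist_le x y

theorem IsDevelopingMap.lipschitzWith_devExtension (hdev : IsDevelopingMap dev) :
    LipschitzWith 1 (devExtension dev) :=
  hdev.lipschitzWith.completion_extension

theorem IsDevelopingMap.devExtension_coe (hdev : IsDevelopingMap dev) (x : X) :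
    devExtension dev (toFlatCompletion X x) = dev x :=
  UniformSpace.Completion.extension_coe (α := FlatSpace X) hdev.lipschitzWith.uniformContinuous x

/-- The closure of a subset in the metric completion. -/
def flatClosure (U : Set X) : Set (FlatCompletion X) := closure (toFlatCompletion X '' U)

theorem subset_flatClosure {x : X} (hx : x ∈ U) : toFlatCompletion X x ∈ flatClosure U :=
  subset_closure (mem_image_of_mem _ hx)

theorem exists_flatDist_lt_of_mem_flatClosure {z : FlatCompletion X} (hz : z ∈ flatClosure U)
    {ε : ℝ} (hε : 0 < ε) : ∃ u ∈ U, dist z (toFlatCompletion X u) < ε := by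
  obtain ⟨_, ⟨u, hu, rfl⟩, h⟩ := Metric.mem_closure_iff.1 hz ε hε
  exact ⟨u, hu, h⟩

theorem IsConvexSubset.dist_devExtension (hU : IsConvexSubset U) (hdev : IsDevelopingMap dev)
    {z w : FlatCompletion X} (hz : z ∈ flatClosure U) (hw : w ∈ flatClosure U) :
    dist (devExtension dev z) (devExtension dev w) = dist z w := by
  have hc := hdev.lipschitzWith_devExtension.continuous
  have h1 : ∀ x ∈ U, ∀ w ∈ flatClosure U, dist (devExtension dev (toFlatCompletion X x))
      (devExtension dev w) = dist (toFlatCompletion X x) w := by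
    intro x hx
    refine fun w hw => closure_minimal (t := {w | dist (devExtension dev (toFlatCompletion X x))
      (devExtension dev w) = dist (toFlatCompletion X x) w}) ?_
      (isClosed_eq (continuous_const.dist hc) (continuous_const.dist continuous_id)) hw
    refine image_subset_iff.2 fun y hy => ?_
    change dist _ _ = dist _ _
    rw [hdev.devExtension_coe, hdev.devExtension_coe, dist_toFlatCompletion,
      hU.flatDist_eq hdev hx hy]
  refine closure_minimal (t := {z | dist (devExtension dev z)
    (devExtension dev w) = dist z w}) ?_
    (isClosed_eq (hc.dist continuous_const) (continuous_id.dist continuous_const)) hz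
  exact image_subset_iff.2 fun x hx => h1 x hx w hw

theorem IsConvexSubset.injOn_devExtension (hU : IsConvexSubset U) (hdev : IsDevelopingMap dev) :
    InjOn (devExtension dev) (flatClosure U) := by
  intro z hz w hw h
  rw [← dist_eq_zero, ← hU.dist_devExtension hdev hz hw, h, dist_self]

theorem IsDevelopingMap.devExtension_mem_closure (hdev : IsDevelopingMap dev)
    {z : FlatCompletion X} (hz : z ∈ flatClosure U) : devExtension dev z ∈ closure (dev '' U) := by
  have := map_mem_closure hdev.lipschitzWith_devExtension.continuous hz
    (t := dev '' U) (by rintro _ ⟨x, hx, rfl⟩; exact ⟨x, hx, (hdev.devExtension_coe x).symm⟩)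
  exact this

/-- A point of the closure that is developed into the image belongs to the surface. -/
theorem IsConvexSubset.mem_range_of_devExtension_mem (hU : IsConvexSubset U)
    (hdev : IsDevelopingMap dev) {z : FlatCompletion X} (hz : z ∈ flatClosure U)
    (h : devExtension dev z ∈ dev '' U) : z ∈ range (toFlatCompletion X) := by
  obtain ⟨v, hv, hvz⟩ := h
  refine ⟨v, hU.injOn_devExtension hdev (subset_flatClosure hv) hz ?_⟩
  rw [hdev.devExtension_coe, hvz]

/-- The surface is open in its completion. A point of the completion within `r` of `x` is a limit of
points of a sheet `W` and is developed into the ball `dev '' W`, so it already lies in the surface.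
-/
theorem IsDevelopingMap.isClosed_surfaceFrontier (hdev : IsDevelopingMap dev) :
    IsClosed (surfaceFrontier X) := by
  rw [surfaceFrontier, isClosed_compl_iff, isOpen_iff_mem_nhds]
  rintro _ ⟨x, rfl⟩
  obtain ⟨r, hr, W, hWo, hxW, hW, hWr⟩ := hdev.exists_ball_sheet x
  filter_upwards [Metric.ball_mem_nhds (toFlatCompletion X x) hr] with z hz
  have hball : dev '' W = Metric.ball (dev x) r := hWr
  refine hW.mem_range_of_devExtension_mem hdev ?_ ?_
  · have h1 := Metric.isOpen_ball.inter_closure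
      (s := Metric.ball (toFlatCompletion X x) r) (t := range (toFlatCompletion X))
      ⟨hz, denseRange_toFlatCompletion z⟩
    refine closure_mono ?_ h1
    rintro _ ⟨hy, ⟨y, rfl⟩⟩
    refine ⟨y, hW.mem_of_flatDist_lt hdev (hball ▸ Metric.isOpen_ball) hxW hball.ge ?_, rfl⟩
    rw [Metric.mem_ball, dist_comm, dist_toFlatCompletion] at hy
    exact hy
  · rw [hball, Metric.mem_ball, ← hdev.devExtension_coe x]
    exact (hdev.lipschitzWith_devExtension.dist_le_mul _ _).trans_lt (by simpa using hz)

theorem IsConvexSubset.mem_flatClosure_of_devExtension_mem (hU : IsConvexSubset U)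
    (hV : IsConvexSubset V) (hdev : IsDevelopingMap dev) (ho : IsOpen (dev '' V)) {a : X}
    (haU : a ∈ U) (haV : a ∈ V) {z : FlatCompletion X} (hz : z ∈ flatClosure U)
    (h : devExtension dev z ∈ dev '' V) : z ∈ flatClosure V := by
  have h1 := (ho.preimage hdev.lipschitzWith_devExtension.continuous).inter_closure ⟨h, hz⟩
  refine closure_mono ?_ h1
  rintro _ ⟨hy, ⟨y, hyU, rfl⟩⟩
  rw [mem_preimage, hdev.devExtension_coe] at hy
  exact ⟨y, hU.mem_of_dev_mem hV hdev haU haV hyU hy, rfl⟩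

/-- A frontier point in the closure of a convex set is not developed into the image of a convex
set that meets the first one. -/
theorem IsConvexSubset.devExtension_notMem (hU : IsConvexSubset U)
    (hV : IsConvexSubset V) (hdev : IsDevelopingMap dev) (ho : IsOpen (dev '' V)) {a : X}
    (haU : a ∈ U) (haV : a ∈ V) {z : FlatCompletion X} (hz : z ∈ flatClosure U)
    (hzF : z ∈ surfaceFrontier X) : devExtension dev z ∉ dev '' V := fun h =>
  hzF (hV.mem_range_of_devExtension_mem hdev
    (hU.mem_flatClosure_of_devExtension_mem hV hdev ho haU haV hz h) h)

/-- The closure is complete and embeds isometrically in the plane with bounded image. -/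
theorem IsConvexSubset.isCompact_flatClosure (hU : IsConvexSubset U) (hdev : IsDevelopingMap dev)
    {S : Set X} (hS : S ⊆ U) (hb : Bornology.IsBounded (dev '' S)) :
    IsCompact (flatClosure S) := by
  have hSU : flatClosure S ⊆ flatClosure U := closure_mono (image_mono hS)
  have hcl : IsClosed (flatClosure S) := isClosed_closure
  have : CompleteSpace (flatClosure S) := hcl.completeSpace_coe
  have hiso : Isometry (fun z : flatClosure S => devExtension dev z) :=
    Isometry.of_dist_eq fun z w => hU.dist_devExtension hdev (hSU z.2) (hSU w.2)
  have hcomp := hiso.isClosedEmbedding.isCompact_preimage hb.isCompact_closure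
  rw [isCompact_iff_isCompact_univ]
  refine hcomp.of_isClosed_subset isClosed_univ fun z _ => ?_
  exact hdev.devExtension_mem_closure z.2

/-- Any part of a closed discrete set is closed, so the frontier points outside the compact closure
of `S` stay at a positive distance from it. -/
theorem IsConvexSubset.exists_pos_forall_frontier (hU : IsConvexSubset U)
    (hdev : IsDevelopingMap dev) (hF : IsDiscrete (surfaceFrontier X))
    {S : Set X} (hS : S ⊆ U) (hb : Bornology.IsBounded (dev '' S)) :
    ∃ δ > 0, ∀ z ∈ surfaceFrontier X, ∀ u ∈ S, dist z (toFlatCompletion X u) < δ →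
      z ∈ flatClosure S := by
  have hcl : IsClosed (surfaceFrontier X \ flatClosure S) :=
    isClosed_of_subset_discrete_closed sdiff_subset hF hdev.isClosed_surfaceFrontier
  obtain ⟨δ, hδ, hd⟩ := (disjoint_sdiff_right : Disjoint (flatClosure S)
    (surfaceFrontier X \ flatClosure S)).exists_thickenings
      (hU.isCompact_flatClosure hdev hS hb) hcl
  refine ⟨δ, hδ, fun z hz u hu hzu => ?_⟩
  by_contra hzS
  exact disjoint_left.1 hd (Metric.mem_thickening_iff.2 ⟨_, subset_flatClosure hu, hzu⟩)
    (Metric.self_subset_thickening hδ _ ⟨hz, hzS⟩)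

/-- An interior point of the image of the carrier lies in the surface, so on the surface frontier
the closure and the topological frontier agree. -/
theorem conePoints_eq (U : LiftedSubconic dev) :
    U.conePoints = flatClosure U.carrier ∩ surfaceFrontier X := by
  ext z
  constructor
  · rintro ⟨h, hF⟩
    exact ⟨frontier_subset_closure h, hF⟩
  · rintro ⟨h, hF⟩
    exact ⟨⟨h, fun hi => hF (image_subset_range _ _ (interior_subset hi))⟩, hF⟩

end Convex

/-! ### Covering transformations -/

section Shift

variable {X : Type*} [TopologicalSpace X] [ChartedSpace Plane X]
  {dev : X → Plane} {φ : X ≃ₜ X} {w : Plane}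

/-- A homeomorphism that is developed to the translation by `w`. -/
def IsDevShift (dev : X → Plane) (φ : X ≃ₜ X) (w : Plane) : Prop := ∀ x, dev (φ x) = dev x + w

theorem IsDevShift.symm (h : IsDevShift dev φ w) : IsDevShift dev φ.symm (-w) := by
  intro x
  have := h (φ.symm x)
  rw [φ.apply_symm_apply] at this
  rw [this]
  simp

theorem IsDevShift.trans {ψ : X ≃ₜ X} {w' : Plane} (h : IsDevShift dev φ w)
    (h' : IsDevShift dev ψ w') : IsDevShift dev (φ.trans ψ) (w + w') := by
  intro x
  rw [Homeomorph.trans_apply, h', h, add_assoc]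

theorem IsDevShift.image_image (h : IsDevShift dev φ w) (U : Set X) :
    dev '' (φ '' U) = (fun p => p + w) '' (dev '' U) := by
  rw [Set.image_image, Set.image_image]
  exact image_congr fun x _ => h x

theorem IsDevShift.mem_image_iff (h : IsDevShift dev φ w) {U : Set X} {p : Plane} :
    p ∈ dev '' (φ '' U) ↔ p - w ∈ dev '' U := by
  rw [h.image_image]
  constructor
  · rintro ⟨q, hq, rfl⟩
    simpa using hq
  · intro hp
    exact ⟨p - w, hp, by simp⟩

theorem IsDevShift.isTranslationMap (h : IsDevShift dev φ w) (hdev : IsDevelopingMap dev) :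
    IsTranslationMap φ := by
  refine ⟨φ.continuous, fun e he e' he' x hx hx' => ?_⟩
  obtain ⟨c, hc⟩ := hdev e he x hx
  obtain ⟨c', hc'⟩ := hdev e' he' (φ x) hx'
  refine ⟨c + w - c', ?_⟩
  filter_upwards [hc, φ.continuous.continuousAt.eventually hc'] with y hy hy'
  rw [h, hy] at hy'
  rw [← add_sub_assoc, ← add_assoc, hy']
  simp

theorem IsDevShift.flatEDist_eq (h : IsDevShift dev φ w) (hdev : IsDevelopingMap dev) (x y : X) :
    flatEDist X (φ x) (φ y) = flatEDist X x y := by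
  refine le_antisymm ((h.isTranslationMap hdev).flatEDist_le x y) ?_
  simpa using (h.symm.isTranslationMap hdev).flatEDist_le (φ x) (φ y)

theorem IsDevShift.isConvexSubset (h : IsDevShift dev φ w) (hdev : IsDevelopingMap dev)
    {U : Set X} (hU : IsConvexSubset U) : IsConvexSubset (φ '' U) := by
  rintro _ ⟨x, hx, rfl⟩ _ ⟨y, hy, rfl⟩
  obtain ⟨γ, hγ, hγU⟩ := hU x hx y hy
  rw [hdev.isGeodesicSegment_iff] at hγ
  refine ⟨γ.map φ.continuous, ?_, fun t => ⟨γ t, hγU t, rfl⟩⟩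
  rw [hdev.isGeodesicSegment_iff]
  intro s
  rw [Path.map_coe, Function.comp_apply, h, h, h, hγ]
  module

/-- The extension of a homeomorphism to the metric completion. -/
def flatMap (φ : X ≃ₜ X) : FlatCompletion X → FlatCompletion X :=
  UniformSpace.Completion.map (α := FlatSpace X) (β := FlatSpace X) φ

variable [TranslationSurface X]

theorem IsDevShift.flatDist_eq (h : IsDevShift dev φ w) (hdev : IsDevelopingMap dev) (x y : X) :
    flatDist (φ x) (φ y) = flatDist x y :=
  congrArg ENNReal.toReal (h.flatEDist_eq hdev x y)

theorem IsDevShift.isometry (h : IsDevShift dev φ w) (hdev : IsDevelopingMap dev) :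
    Isometry (α := FlatSpace X) (β := FlatSpace X) φ :=
  Isometry.of_dist_eq (α := FlatSpace X) (β := FlatSpace X) (h.flatDist_eq hdev)

theorem IsDevShift.isometry_flatMap (h : IsDevShift dev φ w) (hdev : IsDevelopingMap dev) :
    Isometry (flatMap φ) :=
  (h.isometry hdev).completion_map

theorem IsDevShift.flatMap_coe (h : IsDevShift dev φ w) (hdev : IsDevelopingMap dev) (x : X) :
    flatMap φ (toFlatCompletion X x) = toFlatCompletion X (φ x) :=
  UniformSpace.Completion.map_coe (α := FlatSpace X) (β := FlatSpace X)
    (h.isometry hdev).uniformContinuous x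

theorem IsDevShift.flatMap_symm_flatMap (h : IsDevShift dev φ w) (hdev : IsDevelopingMap dev)
    (z : FlatCompletion X) : flatMap φ.symm (flatMap φ z) = z := by
  have hc : Continuous fun z => flatMap φ.symm (flatMap φ z) :=
    (h.symm.isometry_flatMap hdev).continuous.comp (h.isometry_flatMap hdev).continuous
  refine congrFun (denseRange_toFlatCompletion.equalizer hc continuous_id ?_) z
  funext x
  simp [h.flatMap_coe hdev, h.symm.flatMap_coe hdev]

theorem IsDevShift.devExtension_flatMap (h : IsDevShift dev φ w) (hdev : IsDevelopingMap dev)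
    (z : FlatCompletion X) : devExtension dev (flatMap φ z) = devExtension dev z + w := by
  have hc := hdev.lipschitzWith_devExtension.continuous
  refine congrFun (denseRange_toFlatCompletion.equalizer
    (hc.comp (h.isometry_flatMap hdev).continuous) (hc.add continuous_const) ?_) z
  funext x
  simp [h.flatMap_coe hdev, hdev.devExtension_coe, h x]

theorem IsDevShift.flatMap_mem_surfaceFrontier (h : IsDevShift dev φ w)
    (hdev : IsDevelopingMap dev) {z : FlatCompletion X} (hz : z ∈ surfaceFrontier X) :
    flatMap φ z ∈ surfaceFrontier X := by
  rintro ⟨x, hx⟩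
  refine hz ⟨φ.symm x, ?_⟩
  rw [← h.symm.flatMap_coe hdev, hx, h.flatMap_symm_flatMap hdev]

theorem IsDevShift.flatMap_mem_flatClosure (h : IsDevShift dev φ w)
    (hdev : IsDevelopingMap dev) {U : Set X} {z : FlatCompletion X} (hz : z ∈ flatClosure U) :
    flatMap φ z ∈ flatClosure (φ '' U) := by
  refine map_mem_closure (h.isometry_flatMap hdev).continuous hz ?_
  rintro _ ⟨x, hx, rfl⟩
  exact ⟨φ x, mem_image_of_mem _ hx, (h.flatMap_coe hdev x).symm⟩

/-- Since `q ∘ φ = q` and both `q` and `dev` are translations in charts, `dev ∘ φ - dev` is locally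
constant; the surface is connected. -/
theorem IsDevelopingMap.exists_isDevShift (hdev : IsDevelopingMap dev) {Z : Type*}
    [TopologicalSpace Z] [ChartedSpace Plane Z] {q : X → Z} (hq : IsTranslationMap q)
    (hφ : q ∘ φ = q) : ∃ w, IsDevShift dev φ w := by
  have hloc : IsLocallyConstant fun x => dev (φ x) - dev x := by
    rw [IsLocallyConstant.iff_eventually_eq]
    intro x
    obtain ⟨a, ha⟩ := hdev.eventually_eq x
    obtain ⟨b, hb⟩ := hdev.eventually_eq (φ x)
    obtain ⟨c, hc⟩ := hq.eventually_chartAt x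
    obtain ⟨d, hd⟩ := hq.eventually_chartAt (φ x)
    have hqx : q (φ x) = q x := congrFun hφ x
    have h1 : ∀ y, dev y = chartAt Plane x y + a → dev (φ y) = chartAt Plane (φ x) (φ y) + b →
        chartAt Plane (q x) (q y) = chartAt Plane x y + c →
        chartAt Plane (q (φ x)) (q (φ y)) = chartAt Plane (φ x) (φ y) + d →
        dev (φ y) - dev y = c - a - d + b := by
      intro y e1 e2 e3 e4
      have hqy : q (φ y) = q y := congrFun hφ y
      rw [hqx, hqy, e3, ← sub_eq_iff_eq_add] at e4
      rw [e1, e2, ← e4]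
      abel
    have hφc := φ.continuous.continuousAt (x := x)
    filter_upwards [ha, hφc.eventually hb, hc, hφc.eventually hd] with y e1 e2 e3 e4
    rw [h1 y e1 e2 e3 e4, h1 x ha.self_of_nhds hb.self_of_nhds hc.self_of_nhds hd.self_of_nhds]
  obtain ⟨x₀⟩ := (inferInstance : Nonempty X)
  refine ⟨dev (φ x₀) - dev x₀, fun x => ?_⟩
  rw [← hloc.apply_eq_of_isPreconnected isPreconnected_univ (mem_univ x) (mem_univ x₀)]
  simp

end Shift

/-! ### Lifting through the two coverings, and recurrence -/

section Cover

variable {Y X Xt : Type*}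
  [TopologicalSpace Y] [ChartedSpace Plane Y]
  [TopologicalSpace X] [ChartedSpace Plane X]
  [TopologicalSpace Xt] [ChartedSpace Plane Xt]
  {p : X → Y} {π : Xt → X}

theorem IsTranslationMap.comp (hp : IsTranslationMap p) (hπ : IsTranslationMap π) :
    IsTranslationMap (p ∘ π) := by
  refine ⟨hp.1.comp hπ.1, fun e he e' he' x hx hx' => ?_⟩
  obtain ⟨a, ha⟩ := hπ.2 e he _ (chart_mem_atlas _ (π x)) x hx (mem_chart_source _ _)
  obtain ⟨b, hb⟩ := hp.2 _ (chart_mem_atlas _ (π x)) e' he' (π x) (mem_chart_source _ _) hx'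
  refine ⟨a + b, ?_⟩
  filter_upwards [ha, hπ.1.continuousAt.eventually hb] with y h1 h2
  rw [Function.comp_apply, h2, h1, add_assoc]

/-- Lifting first through `p` and then through `π` uses only that each of them is a covering, not
that their composite is one. -/
theorem exists_lift_of_comp [SimplyConnectedSpace Xt] (hp : IsCoveringMap p)
    (hπ : IsCoveringMap π) {u u' : Xt} (h : p (π u) = p (π u')) :
    ∃ g : C(Xt, Xt), g u = u' ∧ ∀ x, p (π (g x)) = p (π x) := by
  have : LocallyPathConnectedSpace Xt := ChartedSpace.locallyPathConnectedSpace Plane Xt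
  obtain ⟨f, ⟨hfu, hf⟩, -⟩ := hp.existsUnique_continuousMap_lifts
    ⟨p ∘ π, hp.continuous.comp hπ.continuous⟩ u (π u') h.symm
  obtain ⟨g, ⟨hgu, hg⟩, -⟩ := hπ.existsUnique_continuousMap_lifts f u u' hfu.symm
  refine ⟨g, hgu, fun x => ?_⟩
  have h1 : π (g x) = f x := congrFun hg x
  rw [h1]
  exact congrFun hf x

theorem eq_id_of_lift [PreconnectedSpace Xt] (hp : IsCoveringMap p) (hπ : IsCoveringMap π)
    {g : Xt → Xt} (hg : Continuous g) {u : Xt} (hu : g u = u)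
    (h : ∀ x, p (π (g x)) = p (π x)) (x : Xt) : g x = x := by
  have h1 : π ∘ g = π := hp.eq_of_comp_eq (hπ.continuous.comp hg) hπ.continuous (funext h) u
    (congrArg π hu)
  exact congrFun (hπ.eq_of_comp_eq hg continuous_id h1 u hu) x

/-- The covering transformations of a simply connected covering space act transitively on the
fibres. -/
theorem exists_homeomorph_of_comp [SimplyConnectedSpace Xt] (hp : IsCoveringMap p)
    (hπ : IsCoveringMap π) {u u' : Xt} (h : p (π u) = p (π u')) :
    ∃ φ : Xt ≃ₜ Xt, φ u = u' ∧ (p ∘ π) ∘ φ = p ∘ π := by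
  obtain ⟨g, hgu, hg⟩ := exists_lift_of_comp hp hπ h
  obtain ⟨k, hku, hk⟩ := exists_lift_of_comp hp hπ h.symm
  refine ⟨⟨⟨g, k, ?_, ?_⟩, g.continuous, k.continuous⟩, hgu, funext hg⟩
  · exact eq_id_of_lift hp hπ (g := k ∘ g) (k.continuous.comp g.continuous) (u := u)
      (by simp [hgu, hku]) fun x => by simp [hk, hg]
  · exact eq_id_of_lift hp hπ (g := g ∘ k) (g.continuous.comp k.continuous) (u := u')
      (by simp [hgu, hku]) fun x => by simp [hk, hg]

attribute [local instance] flatTangentENorm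

/-- A path in `Y` of length less than `r` lifts to `Xt` in two stages, and translation maps preserve
length. -/
theorem exists_lift_flatEDist_lt (hp : IsCoveringMap p) (hpt : IsTranslationMap p)
    (hπ : IsCoveringMap π) (hπt : IsTranslationMap π) {u : Xt} {y : Y} {r : ℝ≥0∞}
    (h : flatEDist Y (p (π u)) y < r) : ∃ x : Xt, p (π x) = y ∧ flatEDist Xt u x < r := by
  obtain ⟨c, h0, h1, hc, hl⟩ := exists_path_of_flatEDist_lt h
  let c' : C(unitInterval, Y) := ⟨fun t => c t, hc.continuousOn.comp_continuous
    continuous_subtype_val fun t => t.2⟩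
  have hc0 : c' 0 = p (π u) := h0
  let d := hp.liftPath c' (π u) hc0
  have hd0 : d 0 = π u := hp.liftPath_zero c' (π u) hc0
  let k := hπ.liftPath d u hd0
  have hk0 : k 0 = u := hπ.liftPath_zero d u hd0
  have hk : ∀ t, p (π (k t)) = c t := by
    intro t
    have e1 : π (k t) = d t := congrFun (hπ.liftPath_lifts d u hd0) t
    rw [e1]
    exact congrFun (hp.liftPath_lifts c' (π u) hc0) t
  refine ⟨k 1, (hk 1).trans h1, ?_⟩
  -- The lift lives on the unit interval; extended by constants to the line, it lies over `c` on
  -- `[0, 1]`, which is all that the length sees.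
  have heq : EqOn ((p ∘ π) ∘ fun t => k (projIcc 0 1 zero_le_one t)) c (Icc 0 1) := by
    intro t ht
    simp only [Function.comp_apply, hk, projIcc_of_mem zero_le_one ht]
  refine lt_of_le_of_lt ?_ hl
  rw [← Manifold.pathELength_congr heq]
  exact (hpt.comp hπt).flatEDist_le_pathELength_comp
    (k.continuous.comp continuous_projIcc).continuousOn (hc.congr heq) (by simp [hk0]) (by simp)

theorem IsPrecompactSurface.exists_finite_cover (hY : IsPrecompactSurface Y) {r : ℝ≥0∞}
    (hr : 0 < r) : ∃ t : Set Y, t.Finite ∧ ∀ x : Y, ∃ y ∈ t, flatEDist Y x y < r := by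
  obtain ⟨t, ht, hcov⟩ := EMetric.totallyBounded_iff.1 hY r hr
  refine ⟨t, ht, fun x => ?_⟩
  obtain ⟨y, hy, h⟩ := mem_iUnion₂.1 (hcov (mem_univ x))
  exact ⟨y, hy, h⟩

/-- Recurrence: two terms of a sequence become close after a covering transformation. -/
theorem exists_recurrence [TranslationSurface Xt] [SimplyConnectedSpace Xt]
    (hY : IsPrecompactSurface Y)
    (hp : IsCoveringMap p) (hpt : IsTranslationMap p)
    (hπ : IsCoveringMap π) (hπt : IsTranslationMap π)
    {dev : Xt → Plane} (hdev : IsDevelopingMap dev) (u : ℕ → Xt) {ε : ℝ} (hε : 0 < ε) :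
    ∃ n m, n < m ∧ ∃ (φ : Xt ≃ₜ Xt) (w : Plane), IsDevShift dev φ w ∧
      flatDist (u n) (φ (u m)) < ε := by
  obtain ⟨t, ht, hcov⟩ := hY.exists_finite_cover (r := ENNReal.ofReal (ε / 2)) (by simpa)
  have hmem : ∀ n, ∃ y : t, flatEDist Y (p (π (u n))) y < ENNReal.ofReal (ε / 2) := fun n =>
    let ⟨y, hy, h⟩ := hcov (p (π (u n)))
    ⟨⟨y, hy⟩, h⟩
  choose f hf using hmem
  have : Finite t := ht
  -- Pigeonhole: infinitely many terms and a finite `ε / 2`-net, so two terms lie near the same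
  -- point of the net.
  obtain ⟨n, m, hnm, hfe⟩ : ∃ n m, n < m ∧ f n = f m := by
    obtain ⟨n, m, hne, h⟩ := Finite.exists_ne_map_eq_of_infinite f
    rcases lt_or_gt_of_ne hne with h' | h'
    · exact ⟨n, m, h', h⟩
    · exact ⟨m, n, h', h.symm⟩
  have hlt : flatEDist Y (p (π (u n))) (p (π (u m))) < ENNReal.ofReal ε := by
    refine (flatEDist_triangle _ (f n : Y) _).trans_lt ?_
    rw [← add_halves ε, ENNReal.ofReal_add (by positivity) (by positivity)]
    refine ENNReal.add_lt_add (hf n) ?_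
    rw [hfe, flatEDist_comm]
    exact hf m
  obtain ⟨x, hx, hux⟩ := exists_lift_flatEDist_lt hp hpt hπ hπt hlt
  obtain ⟨φ, hφ, hφc⟩ := exists_homeomorph_of_comp hp hπ hx.symm
  obtain ⟨w, hw⟩ := hdev.exists_isDevShift (hpt.comp hπt) hφc
  refine ⟨n, m, hnm, φ, w, hw, ?_⟩
  rw [hφ]
  rwa [flatEDist_eq_ofReal, ENNReal.ofReal_lt_ofReal_iff hε] at hux

end Cover

/-! ### Planar subconics -/

section Forms

variable {q q' : Form3} {p e n v : Plane}

/-- The vector `(v₁, v₂, 0)` of `ℝ³`. -/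
def dirVec (v : Plane) : Fin 3 → ℝ := ![v 0, v 1, 0]

theorem hat_add (p v : Plane) : hat (p + v) = hat p + dirVec v := by
  ext i
  fin_cases i <;> simp [hat, dirVec]

theorem dirVec_add (v w : Plane) : dirVec (v + w) = dirVec v + dirVec w := by
  ext i
  fin_cases i <;> simp [dirVec]

theorem dirVec_smul (s : ℝ) (v : Plane) : dirVec (s • v) = s • dirVec v := by
  ext i
  fin_cases i <;> simp [dirVec]

theorem form_add_smul (q : Form3) (P A B : Fin 3 → ℝ) (s y : ℝ) :
    q (P + s • A + y • B) = s ^ 2 * q A + s * y * QuadraticMap.polar q A B + y ^ 2 * q B +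
      s * QuadraticMap.polar q P A + y * QuadraticMap.polar q P B + q P := by
  have h := QuadraticMap.map_add q (P + s • A) (y • B)
  rw [h, QuadraticMap.map_add q P (s • A), QuadraticMap.polar_add_left,
    QuadraticMap.polar_smul_right, QuadraticMap.polar_smul_right, QuadraticMap.polar_smul_left,
    QuadraticMap.polar_smul_right, QuadraticMap.map_smul, QuadraticMap.map_smul]
  simp only [smul_eq_mul]
  ring

/-- A form in an affine frame. -/
theorem form_frame (q : Form3) (p e n : Plane) (s y : ℝ) :
    q (hat (p + s • e + y • n)) = s ^ 2 * q (dirVec e) +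
      s * y * QuadraticMap.polar q (dirVec e) (dirVec n) + y ^ 2 * q (dirVec n) +
      s * QuadraticMap.polar q (hat p) (dirVec e) +
      y * QuadraticMap.polar q (hat p) (dirVec n) + q (hat p) := by
  rw [hat_add, hat_add, dirVec_smul, dirVec_smul, form_add_smul]

theorem form_line (q : Form3) (p v : Plane) (t : ℝ) :
    q (hat (p + t • v)) = t ^ 2 * q (dirVec v) +
      t * QuadraticMap.polar q (hat p) (dirVec v) + q (hat p) := by
  have := form_frame q p v 0 t 0
  simpa using this

theorem continuous_hat : Continuous hat := by
  refine continuous_pi fun i => ?_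
  fin_cases i
  · exact (continuous_apply (0 : Fin 2)).comp (PiLp.continuous_ofLp 2 fun _ : Fin 2 => ℝ)
  · exact (continuous_apply (1 : Fin 2)).comp (PiLp.continuous_ofLp 2 fun _ : Fin 2 => ℝ)
  · exact continuous_const

theorem continuous_eval (x : Fin 3 → ℝ) : Continuous fun q : Form3 => q x :=
  (continuous_apply x).comp continuous_induced_dom

/-- Six values of the form give its coefficients, so pointwise convergence of forms yields joint
continuity in the form and the vector. -/
theorem form_eq_sum (q : Form3) (x : Fin 3 → ℝ) :
    q x = x 0 ^ 2 * q ![1, 0, 0] + x 0 * x 1 * (q (![1, 0, 0] + ![0, 1, 0]) - q ![1, 0, 0] -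
      q ![0, 1, 0]) + x 1 ^ 2 * q ![0, 1, 0] +
      x 0 * x 2 * (q (![0, 0, 1] + ![1, 0, 0]) - q ![0, 0, 1] - q ![1, 0, 0]) +
      x 1 * x 2 * (q (![0, 0, 1] + ![0, 1, 0]) - q ![0, 0, 1] - q ![0, 1, 0]) +
      x 2 ^ 2 * q ![0, 0, 1] := by
  have h := form_add_smul q (x 2 • ![0, 0, 1]) ![1, 0, 0] ![0, 1, 0] (x 0) (x 1)
  rw [QuadraticMap.polar_smul_left, QuadraticMap.polar_smul_left, QuadraticMap.map_smul] at h
  have hx : x = x 2 • ![0, 0, 1] + x 0 • ![1, 0, 0] + x 1 • ![0, 1, 0] := by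
    ext i
    fin_cases i <;> simp
  rw [← hx] at h
  rw [h]
  simp only [QuadraticMap.polar, smul_eq_mul]
  ring

theorem continuous_form_uncurry : Continuous fun z : Form3 × (Fin 3 → ℝ) => z.1 z.2 := by
  have h : ∀ x : Fin 3 → ℝ, Continuous fun z : Form3 × (Fin 3 → ℝ) => z.1 x := fun x =>
    (continuous_eval x).comp continuous_fst
  have hc : ∀ i, Continuous fun z : Form3 × (Fin 3 → ℝ) => z.2 i := fun i =>
    (continuous_apply i).comp continuous_snd
  simp only [form_eq_sum _ (Prod.snd _)]
  have h1 := h ![1, 0, 0]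
  have h2 := h ![0, 1, 0]
  have h3 := h ![0, 0, 1]
  have h4 := h (![1, 0, 0] + ![0, 1, 0])
  have h5 := h (![0, 0, 1] + ![1, 0, 0])
  have h6 := h (![0, 0, 1] + ![0, 1, 0])
  have c0 := hc 0
  have c1 := hc 1
  have c2 := hc 2
  exact ((((((c0.pow 2).mul h1).add ((c0.mul c1).mul ((h4.sub h1).sub h2))).add
    ((c1.pow 2).mul h2)).add ((c0.mul c2).mul ((h5.sub h3).sub h1))).add
    ((c1.mul c2).mul ((h6.sub h3).sub h2))).add ((c2.pow 2).mul h3)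

theorem continuous_form_hat (q : Form3) : Continuous fun p : Plane => q (hat p) :=
  continuous_form_uncurry.comp (continuous_const.prodMk continuous_hat)

theorem isOpen_conicSublevel (q : Form3) : IsOpen (conicSublevel q) :=
  isOpen_lt (continuous_form_hat q) continuous_const

theorem form_nonpos_of_mem_closure (h : p ∈ closure (conicSublevel q)) : q (hat p) ≤ 0 :=
  closure_minimal (t := {p | q (hat p) ≤ 0}) (fun x (hx : q (hat x) < 0) => hx.le)
    (isClosed_le (continuous_form_hat q) continuous_const) h

/-- A point is at positive distance from a nontrivial subconic only if the form is positive. -/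
theorem form_pos_of_notMem_closure (hq : (conicSublevel q).Nonempty)
    (h : p ∉ closure (conicSublevel q)) : 0 < q (hat p) := by
  have hev : ∀ᶠ x in 𝓝 p, 0 ≤ q (hat x) := by
    filter_upwards [isClosed_closure.isOpen_compl.mem_nhds h] with x hx
    by_contra hlt
    exact hx (subset_closure (not_le.1 hlt))
  -- If `q` vanished at `p`, along the line to a point `o` of the sublevel it would be `A t² + B t`.
  -- This is nonnegative for small `t` of both signs, which contradicts the negative value `A + B`
  -- at `o`; the comparison is made at `±δ / 2`, or directly at `1` when `δ / 2 > 1`.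
  refine lt_of_le_of_ne hev.self_of_nhds fun h0 => ?_
  obtain ⟨o, ho⟩ := hq
  have hline : ∀ᶠ t in 𝓝 (0 : ℝ), 0 ≤ q (hat (p + t • (o - p))) := by
    have hc : Filter.Tendsto (fun t : ℝ => p + t • (o - p)) (𝓝 0) (𝓝 p) := by
      have : Continuous fun t : ℝ => p + t • (o - p) := by fun_prop
      simpa using this.tendsto 0
    exact hc.eventually hev
  obtain ⟨δ, hδ, hball⟩ := Metric.eventually_nhds_iff.1 hline
  have h1 := hball (y := δ / 2) (by simp [abs_of_pos hδ]; linarith)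
  have h2 := hball (y := -(δ / 2)) (by simp [abs_of_pos hδ]; linarith)
  have h3 : q (hat (p + (1 : ℝ) • (o - p))) < 0 := by
    have : p + (1 : ℝ) • (o - p) = o := by module
    rw [this]
    exact ho
  rw [form_line, ← h0] at h1 h2 h3
  have h4 : 0 ≤ (δ / 2) ^ 2 * q (dirVec (o - p)) := by linarith
  have h5 : 0 ≤ q (dirVec (o - p)) := nonneg_of_mul_nonneg_right h4 (by positivity)
  rcases lt_or_ge (QuadraticMap.polar q (hat p) (dirVec (o - p))) 0 with hB | hB
  · have : q (dirVec (o - p)) < -QuadraticMap.polar q (hat p) (dirVec (o - p)) := by linarith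
    rcases le_or_gt (δ / 2) 1 with hd | hd
    · have h6 : 0 ≤ δ / 2 * (δ / 2 * q (dirVec (o - p)) +
          QuadraticMap.polar q (hat p) (dirVec (o - p))) := by linarith
      have h7 := nonneg_of_mul_nonneg_right h6 (by positivity)
      linarith [mul_le_mul_of_nonneg_right hd h5]
    · have h6 := hball (y := min (δ / 2) 1) (by
        rw [dist_zero_right, Real.norm_of_nonneg (by positivity)]
        exact (min_le_left _ _).trans_lt (by linarith))
      rw [min_eq_right hd.le, form_line, ← h0] at h6
      linarith
  · linarith

theorem isOpen_setOf_form_pos {K : Set Plane} (hK : IsCompact K) :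
    IsOpen {q : Form3 | ∀ p ∈ K, 0 < q (hat p)} := by
  have hc : Continuous fun z : Form3 × Plane => z.1 (hat z.2) :=
    continuous_form_uncurry.comp (continuous_fst.prodMk (continuous_hat.comp continuous_snd))
  rw [isOpen_iff_mem_nhds]
  intro q hq
  exact hK.eventually_forall_of_forall_eventually fun p hp =>
    (isOpen_lt continuous_const hc).mem_nhds (hq p hp)

/-- Missing the closure means that the form is strictly positive on `K`, an open condition for
compact `K`. It serves to confine the neighbours of an ellipse. -/
theorem PlanarSubconic.isOpen_setOf_disjoint_closure {K : Set Plane} (hK : IsCompact K) :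
    IsOpen {C : PlanarSubconic | Disjoint K (closure C.1)} := by
  rw [isOpen_coinduced]
  have : PlanarSubconic.ofForm ⁻¹' {C : PlanarSubconic | Disjoint K (closure C.1)} =
      {q : {q : Form3 // IsNontrivialForm q} | ∀ p ∈ K, 0 < q.1 (hat p)} := by
    ext q
    constructor
    · intro h p hp
      exact form_pos_of_notMem_closure q.2.1 (disjoint_left.1 h hp)
    · intro h
      exact disjoint_left.2 fun p hp hcl => (h p hp).not_ge (form_nonpos_of_mem_closure hcl)
  rw [this]
  exact (isOpen_setOf_form_pos hK).preimage continuous_subtype_val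

/-- The quadratic part of a form with convex nontrivial sublevel is nonnegative. -/
theorem form_dirVec_nonneg (hc : Convex ℝ (conicSublevel q)) (hu : conicSublevel q ≠ univ)
    (v : Plane) : 0 ≤ q (dirVec v) := by
  by_contra! hv
  refine hu (eq_univ_of_forall fun p => ?_)
  set b := QuadraticMap.polar q (hat p) (dirVec v) with hb
  set c := q (hat p) with hcdef
  -- If the quadratic part is negative along `v`, the points `p ± t • v` lie in the sublevel once
  -- `t` is large, and so does their midpoint `p`. The chosen `t` makes the quadratic term dominate
  -- `|b|` and `|c|`.
  obtain ⟨t, ht, h1, h2⟩ : ∃ t > 0, t ^ 2 * q (dirVec v) + t * b + c < 0 ∧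
      t ^ 2 * q (dirVec v) - t * b + c < 0 := by
    refine ⟨1 + (|b| + |c|) / (-q (dirVec v)), ?_, ?_, ?_⟩
    · have : 0 < -q (dirVec v) := by linarith
      positivity
    all_goals
      have ha : 0 < -q (dirVec v) := by linarith
      set a := -q (dirVec v) with ha'
      have hqa : q (dirVec v) = -a := by simp [ha']
      rw [hqa]
      have hk : 0 ≤ (|b| + |c|) / a := by positivity
      set k := (|b| + |c|) / a with hkdef
      have hka : a * k = |b| + |c| := by rw [hkdef]; field_simp
      have b1 := le_abs_self b
      have b2 := neg_abs_le b
      have c1 := le_abs_self c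
      have c2 := abs_nonneg c
      have : (1 + k) * (|b| + |c| - a * (1 + k)) < 0 := by
        rw [show |b| + |c| - a * (1 + k) = -a by rw [← hka]; ring]
        nlinarith
      nlinarith [mul_nonneg hk (sub_nonneg.2 b1), mul_nonneg hk (sub_nonneg.2 b2),
        mul_nonneg hk c2]
  have m1 : p + t • v ∈ conicSublevel q := by
    change q _ < 0
    rw [form_line]
    linarith
  have m2 : p + (-t) • v ∈ conicSublevel q := by
    change q _ < 0
    rw [form_line]
    linarith
  have := hc m1 m2 (a := 1 / 2) (b := 1 / 2) (by norm_num) (by norm_num) (by norm_num)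
  convert this using 1
  module

/-- The quadratic part at `s • v + n` is affine in `s` and bounded below, so its slope vanishes. -/
theorem polar_eq_zero_of_isotropic (h : ∀ v, 0 ≤ q (dirVec v)) (hv : q (dirVec v) = 0)
    (n : Plane) : QuadraticMap.polar q (dirVec v) (dirVec n) = 0 := by
  have key : ∀ s : ℝ, 0 ≤ s * QuadraticMap.polar q (dirVec v) (dirVec n) + q (dirVec n) := by
    intro s
    have h1 := h (s • v + n)
    rw [dirVec_add, dirVec_smul, QuadraticMap.map_add q, QuadraticMap.map_smul,
      QuadraticMap.polar_smul_left, hv] at h1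
    simp only [smul_eq_mul, mul_zero, zero_add] at h1
    linarith
  by_contra hne
  have := key (-(q (dirVec n) + 1) / QuadraticMap.polar q (dirVec v) (dirVec n))
  rw [div_mul_cancel₀ _ hne] at this
  linarith

/-- Along an isotropic direction a form with nonnegative quadratic part has a constant slope. -/
theorem exists_slope_of_isotropic (h : ∀ v, 0 ≤ q (dirVec v)) (hv : q (dirVec v) = 0) :
    ∃ d : ℝ, ∀ p t, q (hat (p + t • v)) = q (hat p) + t * d := by
  refine ⟨QuadraticMap.polar q (hat 0) (dirVec v), fun p t => ?_⟩
  have h0 : hat p = hat 0 + dirVec p := by rw [← hat_add, zero_add]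
  have h1 : QuadraticMap.polar q (hat p) (dirVec v) = QuadraticMap.polar q (hat 0) (dirVec v) := by
    rw [h0, QuadraticMap.polar_add_left, QuadraticMap.polar_comm q (dirVec p),
      polar_eq_zero_of_isotropic h hv, add_zero]
  rw [form_line, hv, h1]
  ring

/-- The determinant of two vectors of the plane. -/
def planeDet (e n : Plane) : ℝ := e 0 * n 1 - e 1 * n 0

theorem exists_frame_coords (h : planeDet e n ≠ 0) (v : Plane) :
    ∃ s y : ℝ, v = s • e + y • n := by
  refine ⟨planeDet v n / planeDet e n, planeDet e v / planeDet e n, ?_⟩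
  ext i
  fin_cases i
  · simp only [Fin.zero_eta, PiLp.add_apply, PiLp.smul_apply, smul_eq_mul]
    field_simp
    simp only [planeDet]
    ring
  · simp only [Fin.mk_one, PiLp.add_apply, PiLp.smul_apply, smul_eq_mul]
    field_simp
    simp only [planeDet]
    ring

theorem exists_smul_of_planeDet_eq_zero (h : planeDet e n = 0) (he : e ≠ 0) :
    ∃ t : ℝ, n = t • e := by
  by_cases h0 : e 0 = 0
  · have h1 : e 1 ≠ 0 := by
      intro h1
      apply he
      ext i
      fin_cases i
      · exact h0
      · exact h1
    refine ⟨n 1 / e 1, ?_⟩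
    ext i
    fin_cases i
    · simp only [planeDet, h0] at h
      have : n 0 = 0 := by
        have : e 1 * n 0 = 0 := by linarith
        exact (mul_eq_zero.1 this).resolve_left h1
      simp [h0, this]
    · simp [h1]
  · refine ⟨n 0 / e 0, ?_⟩
    ext i
    fin_cases i
    · simp [h0]
    · simp only [planeDet] at h
      simp only [Fin.mk_one, PiLp.smul_apply, smul_eq_mul]
      field_simp
      linarith

theorem planeDet_comb (e n : Plane) (a b c d : ℝ) :
    planeDet (a • e + b • n) (c • e + d • n) = (a * d - b * c) * planeDet e n := by
  simp only [planeDet, PiLp.add_apply, PiLp.smul_apply, smul_eq_mul]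
  ring

/-- A line meets a definite conic in at most two points. -/
theorem line_zero_of_definite (h : ∀ v ≠ 0, 0 < q (dirVec v)) {x y : Plane} (hxy : y ≠ x)
    (hx : q (hat x) = 0) (hy : q (hat y) = 0) {t : ℝ} (ht : q (hat (x + t • (y - x))) = 0) :
    t = 0 ∨ t = 1 := by
  have hA := h (y - x) (sub_ne_zero.2 hxy)
  have h1 := form_line q x (y - x) 1
  have : x + (1 : ℝ) • (y - x) = y := by module
  rw [this, hx, hy] at h1
  rw [form_line, hx] at ht
  have h2 : t * (t - 1) * q (dirVec (y - x)) = 0 := by linear_combination ht + t * h1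
  rcases mul_eq_zero.1 h2 with h3 | h3
  · rcases mul_eq_zero.1 h3 with h4 | h4
    · exact Or.inl h4
    · exact Or.inr (by linarith)
  · exact absurd h3 hA.ne'

theorem planeDet_ne_zero_of_definite (h : ∀ v ≠ 0, 0 < q (dirVec v)) {x y z : Plane}
    (hyx : y ≠ x) (hzx : z ≠ x) (hzy : z ≠ y)
    (hx : q (hat x) = 0) (hy : q (hat y) = 0) (hz : q (hat z) = 0) :
    planeDet (y - x) (z - x) ≠ 0 := by
  intro h0
  obtain ⟨t, ht⟩ := exists_smul_of_planeDet_eq_zero h0 (sub_ne_zero.2 hyx)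
  have hz' : z = x + t • (y - x) := by rw [← ht]; module
  rcases line_zero_of_definite h hyx hx hy (t := t) (hz' ▸ hz) with rfl | rfl
  · exact hzx (by rw [hz']; module)
  · exact hzy (by rw [hz']; module)

/-- A conic through five points of a definite conic is proportional to it. -/
theorem exists_proportional_of_five_points (h : ∀ v ≠ 0, 0 < q (dirVec v)) {P : Fin 5 → Plane}
    (hP : Function.Injective P) (hq : ∀ i, q (hat (P i)) = 0) (hq' : ∀ i, q' (hat (P i)) = 0) :
    ∃ l : ℝ, ∀ p, q' (hat p) = l * q (hat p) := by
  have hne : ∀ i j, i ≠ j → P i ≠ P j := fun i j hij => hP.ne hij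
  have hdet : ∀ i j k : Fin 5, j ≠ i → k ≠ i → k ≠ j → planeDet (P j - P i) (P k - P i) ≠ 0 :=
    fun i j k h1 h2 h3 => planeDet_ne_zero_of_definite h (hne _ _ h1) (hne _ _ h2) (hne _ _ h3)
      (hq i) (hq j) (hq k)
  set e := P 1 - P 0 with he
  set n := P 2 - P 0 with hn
  have hen : planeDet e n ≠ 0 := hdet 0 1 2 (by decide) (by decide) (by decide)
  have hA : 0 < q (dirVec e) := h _ (sub_ne_zero.2 (hne 1 0 (by decide)))
  -- With this `l`, the difference `q' - l q` has no `s²` term in the frame `P 0, e, n`. Its zeros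
  -- at `P 0, P 1, P 2` reduce it to `y * (s * B + (y - 1) * C)`. No three of the points are
  -- collinear, so `P 3` and `P 4` are off the line `y = 0`, and the second factor vanishes at `P 2,
  -- P 3, P 4`, which forces `B = C = 0`.
  set l := q' (dirVec e) / q (dirVec e) with hl
  have hlA : q' (dirVec e) = l * q (dirVec e) := by rw [hl]; field_simp
  set B := QuadraticMap.polar q' (dirVec e) (dirVec n) -
    l * QuadraticMap.polar q (dirVec e) (dirVec n) with hB
  set C := q' (dirVec n) - l * q (dirVec n) with hC
  set D := QuadraticMap.polar q' (hat (P 0)) (dirVec e) -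
    l * QuadraticMap.polar q (hat (P 0)) (dirVec e) with hD
  set E := QuadraticMap.polar q' (hat (P 0)) (dirVec n) -
    l * QuadraticMap.polar q (hat (P 0)) (dirVec n) with hE
  have hframe : ∀ s y : ℝ, q' (hat (P 0 + s • e + y • n)) - l * q (hat (P 0 + s • e + y • n)) =
      s * y * B + y ^ 2 * C + s * D + y * E := by
    intro s y
    rw [form_frame, form_frame, hq 0, hq' 0, hlA, hB, hC, hD, hE]
    ring
  have hzero : ∀ i, ∀ s y : ℝ, P i = P 0 + s • e + y • n →
      s * y * B + y ^ 2 * C + s * D + y * E = 0 := by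
    intro i s y hi
    rw [← hframe, ← hi, hq, hq']
    ring
  have h1 := hzero 1 1 0 (by rw [he]; module)
  have h2 := hzero 2 0 1 (by rw [hn]; module)
  have hD0 : D = 0 := by linarith
  have hE0 : E = -C := by linarith
  have hcoord : ∀ i, ∃ s y : ℝ, P i = P 0 + s • e + y • n := by
    intro i
    obtain ⟨s, y, hsy⟩ := exists_frame_coords hen (P i - P 0)
    exact ⟨s, y, by rw [add_assoc, ← hsy]; module⟩
  obtain ⟨s3, y3, h3⟩ := hcoord 3
  obtain ⟨s4, y4, h4⟩ := hcoord 4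
  have hy : ∀ i, i ≠ 0 → i ≠ 1 → ∀ s y : ℝ, P i = P 0 + s • e + y • n → y ≠ 0 := by
    rintro i hi0 hi1 s y hi rfl
    refine hdet 0 1 i (by decide) hi0 hi1 ?_
    have : P i - P 0 = s • e + (0 : ℝ) • n := by rw [hi]; module
    rw [this, show P 1 - P 0 = (1 : ℝ) • e + (0 : ℝ) • n by rw [he]; module, planeDet_comb]
    ring
  have hlin : ∀ i, i ≠ 0 → i ≠ 1 → ∀ s y : ℝ, P i = P 0 + s • e + y • n →
      s * B + (y - 1) * C = 0 := by
    intro i hi0 hi1 s y hi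
    have := hzero i s y hi
    rw [hD0, hE0] at this
    have h' : y * (s * B + (y - 1) * C) = 0 := by linear_combination this
    exact (mul_eq_zero.1 h').resolve_left (hy i hi0 hi1 s y hi)
  have l3 := hlin 3 (by decide) (by decide) s3 y3 h3
  have l4 := hlin 4 (by decide) (by decide) s4 y4 h4
  have hd : s3 * (y4 - 1) - (y3 - 1) * s4 ≠ 0 := by
    intro h0
    refine hdet 2 3 4 (by decide) (by decide) (by decide) ?_
    rw [show P 3 - P 2 = s3 • e + (y3 - 1) • n by rw [h3, hn]; module,
      show P 4 - P 2 = s4 • e + (y4 - 1) • n by rw [h4, hn]; module, planeDet_comb, h0, zero_mul]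
  have hB0 : B = 0 := by
    have : (s3 * (y4 - 1) - (y3 - 1) * s4) * B = 0 := by
      linear_combination (y4 - 1) * l3 - (y3 - 1) * l4
    exact (mul_eq_zero.1 this).resolve_left hd
  have hC0 : C = 0 := by
    have : (s3 * (y4 - 1) - (y3 - 1) * s4) * C = 0 := by
      linear_combination s3 * l4 - s4 * l3
    exact (mul_eq_zero.1 this).resolve_left hd
  refine ⟨l, fun p => ?_⟩
  obtain ⟨s, y, hsy⟩ := exists_frame_coords hen (p - P 0)
  have hp : p = P 0 + s • e + y • n := by rw [add_assoc, ← hsy]; module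
  have := hframe s y
  rw [hB0, hC0, hD0, hE0, hC0, ← hp] at this
  linarith

/-- The forms are proportional, and the common point `o` makes the factor positive. -/
theorem conicSublevel_eq_of_five_points (h : ∀ v ≠ 0, 0 < q (dirVec v)) {P : Fin 5 → Plane}
    (hP : Function.Injective P) (hq : ∀ i, q (hat (P i)) = 0) (hq' : ∀ i, q' (hat (P i)) = 0)
    {o : Plane} (ho : o ∈ conicSublevel q) (ho' : o ∈ conicSublevel q') :
    conicSublevel q = conicSublevel q' := by
  obtain ⟨l, hl⟩ := exists_proportional_of_five_points h hP hq hq'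
  have hpos : 0 < l := by
    have h1 : q' (hat o) < 0 := ho'
    have h2 : q (hat o) < 0 := ho
    rw [hl] at h1
    nlinarith
  ext p
  change q (hat p) < 0 ↔ q' (hat p) < 0
  rw [hl]
  constructor
  · intro h1
    nlinarith
  · intro h1
    by_contra h2
    nlinarith [mul_nonneg hpos.le (not_lt.1 h2)]

theorem abs_le_of_sq_le {α β γ t : ℝ} (hα : 0 < α) (h : α * t ^ 2 ≤ β * t + γ) :
    |t| ≤ 1 + (|β| + |γ|) / α := by
  by_contra! hlt
  have h1 : 1 ≤ |t| := by
    have : 0 ≤ (|β| + |γ|) / α := by positivity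
    linarith
  have h2 : |β| + |γ| < α * |t| := by
    have : (|β| + |γ|) / α < |t| := by linarith
    rwa [div_lt_iff₀ hα, mul_comm] at this
  have h3 : β * t ≤ |β| * |t| := by rw [← abs_mul]; exact le_abs_self _
  have h4 := le_abs_self γ
  have h5 : t ^ 2 = |t| ^ 2 := (sq_abs t).symm
  rw [h5] at h
  nlinarith [abs_nonneg γ, mul_le_mul_of_nonneg_right h2.le (abs_nonneg t)]

theorem isBounded_conicSublevel_of_definite (h : ∀ v ≠ 0, 0 < q (dirVec v)) :
    Bornology.IsBounded (conicSublevel q) := by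
  set e : Plane := !₂[1, 0] with he
  set n : Plane := !₂[0, 1] with hn
  set a := q (dirVec e) with ha
  set b := QuadraticMap.polar q (dirVec e) (dirVec n) with hb
  set c := q (dirVec n) with hc
  set d := QuadraticMap.polar q (hat 0) (dirVec e) with hd
  set k := QuadraticMap.polar q (hat 0) (dirVec n) with hk
  set f := q (hat 0) with hf
  have hdir : ∀ s y : ℝ, q (dirVec (s • e + y • n)) = s ^ 2 * a + s * y * b + y ^ 2 * c := by
    intro s y
    have := form_add_smul q 0 (dirVec e) (dirVec n) s y
    rw [zero_add, ← dirVec_smul, ← dirVec_smul, ← dirVec_add] at this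
    rw [this, ha, hb, hc]
    simp [QuadraticMap.polar]
  have hne : ∀ s y : ℝ, s ≠ 0 ∨ y ≠ 0 → s • e + y • n ≠ 0 := by
    intro s y hsy h0
    have h1 := congrArg (fun p : Plane => p 0) h0
    have h2 := congrArg (fun p : Plane => p 1) h0
    simp [he, hn] at h1 h2
    tauto
  have ha0 : 0 < a := by
    have h1 := h _ (hne 1 0 (by simp))
    rw [hdir] at h1
    simpa using h1
  have hc0 : 0 < c := by
    have h1 := h _ (hne 0 1 (by simp))
    rw [hdir] at h1
    simpa using h1
  have hdisc : 0 < 4 * a * c - b ^ 2 := by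
    have h1 := h _ (hne (-b) (2 * a) (Or.inr (by positivity)))
    rw [hdir] at h1
    nlinarith
  have hform : ∀ p : Plane, q (hat p) =
      p 0 ^ 2 * a + p 0 * p 1 * b + p 1 ^ 2 * c + p 0 * d + p 1 * k + f := by
    intro p
    have h1 : p = 0 + p 0 • e + p 1 • n := by
      ext i
      fin_cases i <;> simp [he, hn]
    conv_lhs => rw [h1]
    exact form_frame q 0 e n (p 0) (p 1)
  obtain ⟨R, hR⟩ : ∃ R : ℝ, ∀ p ∈ conicSublevel q, |p 0| ≤ R ∧ |p 1| ≤ R := by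
    -- Multiplying the form by `4c` and completing the square in the second coordinate leaves a
    -- quadratic inequality in the first one, with leading coefficient `4ac - b²`; likewise with
    -- `4a` and the coordinates exchanged.
    refine ⟨max (1 + (|2 * b * k - 4 * c * d| + |k ^ 2 - 4 * c * f|) / (4 * a * c - b ^ 2))
      (1 + (|2 * b * d - 4 * a * k| + |d ^ 2 - 4 * a * f|) / (4 * a * c - b ^ 2)), ?_⟩
    intro p hp
    have h1 : q (hat p) < 0 := hp
    rw [hform] at h1
    constructor
    · refine le_trans (abs_le_of_sq_le hdisc ?_) (le_max_left _ _)
      nlinarith [sq_nonneg (2 * c * p 1 + b * p 0 + k)]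
    · refine le_trans (abs_le_of_sq_le hdisc ?_) (le_max_right _ _)
      nlinarith [sq_nonneg (2 * a * p 0 + b * p 1 + d)]
  refine isBounded_iff_forall_norm_le.2 ⟨R + R, fun p hp => ?_⟩
  obtain ⟨h0, h1⟩ := hR p hp
  rw [EuclideanSpace.norm_eq, Fin.sum_univ_two]
  refine Real.sqrt_le_iff.2 ⟨by linarith [abs_nonneg (p 0)], ?_⟩
  rw [Real.norm_eq_abs, Real.norm_eq_abs]
  nlinarith [abs_nonneg (p 0), abs_nonneg (p 1)]

end Forms

/-! ### Conics close to a strip -/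

section StripConics

/-- The quadratic polynomial in two variables with the given coefficients. -/
def quadPoly (a b c d k f s y : ℝ) : ℝ := a * s ^ 2 + b * (s * y) + c * y ^ 2 + d * s + k * y + f

/-- Four times the polynomial is `(2s + by + d)² - D(y)`. The slice at height `y`, where `D y > 0`,
is an interval of length `√(D y)` centred at `-(by + d) / 2`, and `D` is concave because `b² ≤ 4c`.
The slice at height `1 / 2` is long, while the one at height `1` fits between integers and is short,
so by concavity the conic ends just above height `1`, and its points there can be slid down the
slant into the strip. -/
theorem quadPoly_one_near_strip {b c d k f L : ℝ} (hL : 1 ≤ L) (hbc : b ^ 2 ≤ 4 * c)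
    (h1 : quadPoly 1 b c d k f L (1 / 2) < 0) (h2 : quadPoly 1 b c d k f (-L) (1 / 2) < 0)
    (h3 : quadPoly 1 b c d k f 0 (1 / 4) < 0) (h4 : quadPoly 1 b c d k f 0 (3 / 4) < 0)
    (hZ : ∀ m : ℤ, 0 ≤ quadPoly 1 b c d k f m 1) {s y : ℝ} (hy : 1 ≤ y)
    (hsy : quadPoly 1 b c d k f s y < 0) :
    ∃ s' y' : ℝ, 0 < y' ∧ y' < 1 ∧ quadPoly 1 b c d k f s' y' < 0 ∧
      |s - s'| ≤ 1 / L ∧ |y - y'| ≤ 1 / L := by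
  obtain ⟨D, hD⟩ : ∃ D : ℝ → ℝ, ∀ y, D y = (b * y + d) ^ 2 - 4 * (c * y ^ 2 + k * y + f) :=
    ⟨_, fun _ => rfl⟩
  have hid : ∀ s y, (2 * s + b * y + d) ^ 2 - D y = 4 * quadPoly 1 b c d k f s y := by
    intro s y
    rw [hD, quadPoly]
    ring
  have hlt : ∀ s y, quadPoly 1 b c d k f s y < 0 → (2 * s + b * y + d) ^ 2 < D y := by
    intro s y h
    linarith [hid s y]
  have hconc : ∀ u v w : ℝ, u ≤ v → v ≤ w →
      (w - v) * D u + (v - u) * D w ≤ (w - u) * D v := by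
    intro u v w huv hvw
    have key : (w - u) * D v - ((w - v) * D u + (v - u) * D w) =
        (4 * c - b ^ 2) * ((w - u) * (v - u) * (w - v)) := by
      rw [hD, hD, hD]
      ring
    have h0 : 0 ≤ (4 * c - b ^ 2) * ((w - u) * (v - u) * (w - v)) :=
      mul_nonneg (by linarith) (mul_nonneg (mul_nonneg (by linarith) (by linarith)) (by linarith))
    linarith
  have e1 := hlt _ _ h1
  have e2 := hlt _ _ h2
  have e3 := hlt _ _ h3
  have e4 := hlt _ _ h4
  have e5 := hconc (1 / 4) (1 / 2) (3 / 4) (by norm_num) (by norm_num)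
  obtain ⟨G, hGdef⟩ : ∃ G, G = D (1 / 2) := ⟨_, rfl⟩
  -- The slice at height `1 / 2` contains both `L` and `-L`.
  have hG : 4 * L ^ 2 < G := by
    have : 0 ≤ (b * (1 / 2) + d) ^ 2 := sq_nonneg _
    rw [hGdef]
    linarith
  have hL2 : 1 ≤ L ^ 2 := one_le_pow₀ hL
  have hG4 : 4 < G := by linarith
  -- The integer nearest to the centre of the slice is at most `1 / 2` away and is not inside the
  -- slice.
  have hD1 : D 1 ≤ 1 := by
    have hr := abs_sub_round (-(b + d) / 2)
    have hz := hZ (round (-(b + d) / 2))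
    obtain ⟨m, hm⟩ : ∃ m : ℝ, m = (round (-(b + d) / 2) : ℝ) := ⟨_, rfl⟩
    rw [← hm] at hr hz
    have h5 := abs_le.1 hr
    have h6 : (2 * m + b * 1 + d) ^ 2 ≤ 1 := by
      rw [sq_le_one_iff_abs_le_one, abs_le]
      constructor <;> linarith
    linarith [hid m 1]
  -- The slices at heights `1 / 4` and `3 / 4` both contain `0`, so the centres drift little;
  -- concavity bounds `D (1 / 4) + D (3 / 4)` by `2 * G`.
  have hb : b ^ 2 ≤ 16 * G := by
    have : 0 ≤ (b * (1 / 4) + d + (b * (3 / 4) + d)) ^ 2 := sq_nonneg _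
    rw [hGdef]
    linarith
  have hDy : (2 * s + b * y + d) ^ 2 < D y := hlt _ _ hsy
  have hDy0 : 0 < D y := lt_of_le_of_lt (sq_nonneg _) hDy
  have hc1 := hconc (1 / 2) 1 y (by norm_num) hy
  rw [← hGdef] at hc1
  have hc2 : (y - 1 / 2) * D 1 ≤ y - 1 / 2 := mul_le_of_le_one_right (by linarith) hD1
  have hc3 : (y - 1) * 4 ≤ (y - 1) * G := mul_le_mul_of_nonneg_left hG4.le (by linarith)
  have hyG' : (y - 1) * G ≤ 2 / 3 := by linarith
  have hDyG : D y ≤ G := by linarith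
  have hG0 : 0 < G := by linarith
  -- Concavity gave `(y - 1) * G ≤ 2 / 3`; the further `1 / (3 * G)` takes `y'` strictly below `1`
  -- and keeps `(y - y') * G ≤ 1`.
  obtain ⟨y', hy'⟩ : ∃ y' : ℝ, y' = 1 - 1 / (3 * G) := ⟨_, rfl⟩
  have hη : 1 / (3 * G) * G = 1 / 3 := by field_simp
  have hη0 : 0 < 1 / (3 * G) := by positivity
  have hη1 : 1 / (3 * G) < 1 / 2 := by
    rw [div_lt_div_iff₀ (by positivity) (by norm_num)]
    linarith
  have hyy : (y - y') * G ≤ 1 := by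
    rw [hy']
    linarith
  have hyy0 : 0 ≤ y - y' := by linarith
  have hDy' : D y ≤ D y' := by
    have := hconc (1 / 2) y' y (by linarith) (by linarith)
    rw [← hGdef] at this
    have h5 : (y - y') * D y ≤ (y - y') * G := mul_le_mul_of_nonneg_left hDyG hyy0
    have h6 : (y - 1 / 2) * D y ≤ (y - 1 / 2) * D y' := by linarith
    exact le_of_mul_le_mul_left h6 (by linarith)
  have hL0 : 0 < L := by linarith
  -- The point keeps its offset from the centre of its slice, so it stays in the conic because `D y
  -- ≤ D y'`. The horizontal move is controlled by `b² ≤ 16 * G` and `4 * L² < G`.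
  refine ⟨s + b * (y - y') / 2, y', by linarith, by linarith, ?_, ?_, ?_⟩
  · have h6 : 2 * (s + b * (y - y') / 2) + b * y' + d = 2 * s + b * y + d := by ring
    have h7 := hid (s + b * (y - y') / 2) y'
    rw [h6] at h7
    linarith
  · refine abs_le_of_sq_le_sq ?_ (by positivity)
    have h5 : (s - (s + b * (y - y') / 2)) ^ 2 = b ^ 2 * (y - y') ^ 2 / 4 := by ring
    rw [h5, div_pow, one_pow, le_div_iff₀ (by positivity)]
    have h6 : ((y - y') * G) ^ 2 ≤ 1 := pow_le_one₀ (mul_nonneg hyy0 hG0.le) hyy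
    have h7 : b ^ 2 * (y - y') ^ 2 ≤ 16 * G * (y - y') ^ 2 :=
      mul_le_mul_of_nonneg_right hb (sq_nonneg _)
    have h8 : 0 ≤ 4 * G * (y - y') ^ 2 := by positivity
    have h9 : 4 * G * (y - y') ^ 2 * L ^ 2 ≤ 4 * G * (y - y') ^ 2 * (G / 4) :=
      mul_le_mul_of_nonneg_left (by linarith) h8
    have h10 : b ^ 2 * (y - y') ^ 2 / 4 * L ^ 2 ≤ 4 * G * (y - y') ^ 2 * L ^ 2 :=
      mul_le_mul_of_nonneg_right (by linarith) (sq_nonneg L)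
    have h11 : ((y - y') * G) ^ 2 = 4 * G * (y - y') ^ 2 * (G / 4) := by ring
    linarith
  · rw [abs_of_nonneg hyy0, le_div_iff₀ hL0]
    have : L ≤ G := by
      have : L * 1 ≤ L * L := mul_le_mul_of_nonneg_left hL hL0.le
      linarith [sq L]
    exact (mul_le_mul_of_nonneg_left this hyy0).trans hyy

theorem quadPoly_near_strip_above {a b c d k f L : ℝ} (ha : 0 < a) (hL : 1 ≤ L)
    (hbc : b ^ 2 ≤ 4 * a * c)
    (h1 : quadPoly a b c d k f L (1 / 2) < 0) (h2 : quadPoly a b c d k f (-L) (1 / 2) < 0)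
    (h3 : quadPoly a b c d k f 0 (1 / 4) < 0) (h4 : quadPoly a b c d k f 0 (3 / 4) < 0)
    (hZ : ∀ m : ℤ, 0 ≤ quadPoly a b c d k f m 1) {s y : ℝ} (hy : 1 ≤ y)
    (hsy : quadPoly a b c d k f s y < 0) :
    ∃ s' y' : ℝ, 0 < y' ∧ y' < 1 ∧ quadPoly a b c d k f s' y' < 0 ∧
      |s - s'| ≤ 1 / L ∧ |y - y'| ≤ 1 / L := by
  have hscale : ∀ s y, quadPoly a b c d k f s y =
      a * quadPoly 1 (b / a) (c / a) (d / a) (k / a) (f / a) s y := by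
    intro s y
    simp only [quadPoly]
    field_simp
  simp only [hscale, mul_neg_iff, mul_nonneg_iff_of_pos_left ha, ha, ha.not_gt, true_and,
    false_and, or_false] at h1 h2 h3 h4 hZ hsy ⊢
  refine quadPoly_one_near_strip hL ?_ h1 h2 h3 h4 hZ hy hsy
  have ha2 : 0 < a ^ 2 := by positivity
  rw [div_pow, div_le_iff₀ ha2]
  field_simp
  linarith

/-- A conic that contains a long part of the strip `0 < y < 1` and avoids the integer points of its
boundary is close to the strip. -/
theorem quadPoly_near_strip {a b c d k f L : ℝ} (ha : 0 < a) (hL : 1 ≤ L)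
    (hbc : b ^ 2 ≤ 4 * a * c)
    (h1 : quadPoly a b c d k f L (1 / 2) < 0) (h2 : quadPoly a b c d k f (-L) (1 / 2) < 0)
    (h3 : quadPoly a b c d k f 0 (1 / 4) < 0) (h4 : quadPoly a b c d k f 0 (3 / 4) < 0)
    (hZ0 : ∀ m : ℤ, 0 ≤ quadPoly a b c d k f m 0)
    (hZ : ∀ m : ℤ, 0 ≤ quadPoly a b c d k f m 1) {s y : ℝ}
    (hsy : quadPoly a b c d k f s y < 0) :
    ∃ s' y' : ℝ, 0 < y' ∧ y' < 1 ∧ quadPoly a b c d k f s' y' < 0 ∧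
      |s - s'| ≤ 1 / L ∧ |y - y'| ≤ 1 / L := by
  have hL0 : 0 < L := by linarith
  rcases le_or_gt 1 y with hy | hy
  · exact quadPoly_near_strip_above ha hL hbc h1 h2 h3 h4 hZ hy hsy
  rcases lt_or_ge 0 y with hy0 | hy0
  · exact ⟨s, y, hy0, hy, hsy, by simp [hL0.le], by simp [hL0.le]⟩
  -- The reflection `y ↦ 1 - y` exchanges the two boundary lines and reduces `y ≤ 0` to the case `1
  -- ≤ y`.
  have hflip : ∀ s y, quadPoly a (-b) c (d + b) (-2 * c - k) (c + k + f) s y =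
      quadPoly a b c d k f s (1 - y) := by
    intro s y
    simp only [quadPoly]
    ring
  obtain ⟨s', y', h5, h6, h7, h8, h9⟩ := quadPoly_near_strip_above (b := -b) (d := d + b)
    (k := -2 * c - k) (f := c + k + f) (s := s) (y := 1 - y) ha hL (by rwa [neg_sq])
    (by rw [hflip]; norm_num at h1 ⊢; exact h1)
    (by rw [hflip]; norm_num at h2 ⊢; exact h2)
    (by rw [hflip]; norm_num at h4 ⊢; exact h4)
    (by rw [hflip]; norm_num at h3 ⊢; exact h3)
    (by intro m; rw [hflip]; simpa using hZ0 m) (by linarith) (by rw [hflip]; simpa using hsy)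
  refine ⟨s', 1 - y', by linarith, by linarith, by rwa [hflip] at h7, h8, ?_⟩
  rw [abs_sub_comm] at h9
  convert h9 using 2
  ring

theorem form_frame_eq_quadPoly (q : Form3) (p e n : Plane) (s y : ℝ) :
    q (hat (p + s • e + y • n)) = quadPoly (q (dirVec e))
      (QuadraticMap.polar q (dirVec e) (dirVec n)) (q (dirVec n))
      (QuadraticMap.polar q (hat p) (dirVec e)) (QuadraticMap.polar q (hat p) (dirVec n))
      (q (hat p)) s y := by
  rw [form_frame, quadPoly]
  ring

theorem polar_sq_le_of_nonneg {q : Form3} (h : ∀ v, 0 ≤ q (dirVec v)) (e n : Plane) :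
    QuadraticMap.polar q (dirVec e) (dirVec n) ^ 2 ≤ 4 * q (dirVec e) * q (dirVec n) := by
  have hdir : ∀ s y : ℝ, 0 ≤ s ^ 2 * q (dirVec e) +
      s * y * QuadraticMap.polar q (dirVec e) (dirVec n) + y ^ 2 * q (dirVec n) := by
    intro s y
    have h1 := h (s • e + y • n)
    have := form_add_smul q 0 (dirVec e) (dirVec n) s y
    rw [zero_add, ← dirVec_smul, ← dirVec_smul, ← dirVec_add] at this
    rw [this] at h1
    simpa [QuadraticMap.polar] using h1
  set b := QuadraticMap.polar q (dirVec e) (dirVec n)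
  rcases (h e).eq_or_lt with h0 | h0
  · have : b = 0 := polar_eq_zero_of_isotropic h h0.symm n
    rw [this, ← h0]
    norm_num
  · have h1 := hdir (-b) (2 * q (dirVec e))
    have h2 : 0 ≤ q (dirVec e) * (4 * q (dirVec e) * q (dirVec n) - b ^ 2) := by
      linarith
    linarith [nonneg_of_mul_nonneg_right h2 h0]

end StripConics

/-! ### The shape of subconics with many cone points -/

section Shape

variable {X : Type*} [TopologicalSpace X] [ChartedSpace Plane X] [TranslationSurface X]
  {dev : X → Plane}

/-- Any two terms of a sequence, suitably chosen, become close after a transformation that is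
developed to a translation. -/
def HasRecurrence (dev : X → Plane) : Prop :=
  ∀ (u : ℕ → X) (ε : ℝ), 0 < ε → ∃ n m, n < m ∧ ∃ (φ : X ≃ₜ X) (w : Plane),
    IsDevShift dev φ w ∧ flatDist (u n) (φ (u m)) < ε

/-- A subconic with at least five cone points, with developed images of maximal span. -/
def LiftedSubconic.IsRich (U : LiftedSubconic dev) : Prop :=
  ((5 : ℕ) : ℕ∞) ≤ U.conePoints.encard ∧ HasMaximalSpan (devExtension dev '' U.conePoints)

variable {U : LiftedSubconic dev} {q : Form3}

theorem LiftedSubconic.isOpen_image (U : LiftedSubconic dev) : IsOpen (dev '' U.carrier) := by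
  obtain ⟨q, -, h⟩ := U.isSubconic
  exact h ▸ isOpen_conicSublevel q

theorem LiftedSubconic.nonempty (U : LiftedSubconic dev) : U.carrier.Nonempty := by
  obtain ⟨q, hq, h⟩ := U.isSubconic
  exact image_nonempty.1 (h ▸ hq.1)

theorem LiftedSubconic.form_dirVec_nonneg (U : LiftedSubconic dev) (hdev : IsDevelopingMap dev)
    (hq : IsNontrivialForm q) (hU : dev '' U.carrier = conicSublevel q) (v : Plane) :
    0 ≤ q (dirVec v) :=
  _root_.form_dirVec_nonneg (hU ▸ U.convex.convex_image hdev) hq.2 v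

theorem LiftedSubconic.injOn_devExtension (U : LiftedSubconic dev) (hdev : IsDevelopingMap dev) :
    InjOn (devExtension dev) U.conePoints := by
  rw [conePoints_eq]
  exact (U.convex.injOn_devExtension hdev).mono inter_subset_left

theorem LiftedSubconic.devExtension_notMem {V : Set X} (hdev : IsDevelopingMap dev)
    {z : FlatCompletion X} (hz : z ∈ U.conePoints) (hV : IsConvexSubset V)
    (ho : IsOpen (dev '' V)) {a : X} (haU : a ∈ U.carrier) (haV : a ∈ V) :
    devExtension dev z ∉ dev '' V := by
  rw [conePoints_eq] at hz
  exact U.convex.devExtension_notMem hV hdev ho haU haV hz.1 hz.2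

/-- A cone point is a limit of the subconic, so the form is at most `0`; a negative value would
place the point in the surface. -/
theorem LiftedSubconic.form_eq_zero (hdev : IsDevelopingMap dev)
    (hU : dev '' U.carrier = conicSublevel q) {z : FlatCompletion X} (hz : z ∈ U.conePoints) :
    q (hat (devExtension dev z)) = 0 := by
  obtain ⟨a, ha⟩ := U.nonempty
  refine le_antisymm (form_nonpos_of_mem_closure ?_) (not_lt.1 fun h => ?_)
  · rw [← hU]
    rw [conePoints_eq] at hz
    exact hdev.devExtension_mem_closure hz.1
  · refine LiftedSubconic.devExtension_notMem hdev hz U.convex U.isOpen_image ha ha ?_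
    rw [hU]
    exact h

/-- If all differences were parallel to `v`, they would span dimension at most `1`, less than both
`2` and the number of cone points minus one. -/
theorem LiftedSubconic.IsRich.exists_planeDet_ne_zero (hR : U.IsRich)
    (hdev : IsDevelopingMap dev) {v : Plane} (hv : v ≠ 0) :
    ∃ z ∈ U.conePoints, ∃ z' ∈ U.conePoints,
      planeDet v (devExtension dev z' - devExtension dev z) ≠ 0 := by
  by_contra! h
  obtain ⟨h5, B, hB, hspan⟩ := hR
  rw [← (U.injOn_devExtension hdev).encard_image] at h5
  have hle : Submodule.span ℝ {w | ∃ b ∈ B, ∃ b' ∈ B, w = b - b'} ≤ Submodule.span ℝ {v} := by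
    rw [Submodule.span_le]
    rintro _ ⟨b, hb, b', hb', rfl⟩
    obtain ⟨z, hz, rfl⟩ := hB hb
    obtain ⟨z', hz', rfl⟩ := hB hb'
    obtain ⟨t, ht⟩ := exists_smul_of_planeDet_eq_zero (h z' hz' z hz) hv
    rw [ht]
    exact Submodule.smul_mem _ _ (Submodule.mem_span_singleton_self v)
  have hrank := (Submodule.finrank_mono hle).trans_eq (finrank_span_singleton hv)
  rcases hspan with h2 | h2
  · omega
  · have h3 := h5.trans h2
    norm_cast at h3
    omega

/-- A subconic with a cone point has no direction in which its form has a nonzero slope. -/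
theorem LiftedSubconic.slope_eq_zero (hrec : HasRecurrence dev) (hdev : IsDevelopingMap dev)
    (hU : dev '' U.carrier = conicSublevel q) {z : FlatCompletion X} (hz : z ∈ U.conePoints)
    {v : Plane} {d : ℝ} (hv : ∀ p (t : ℝ), q (hat (p + t • v)) = q (hat p) + t * d) :
    d = 0 := by
  wlog hd : d ≤ 0 generalizing v d
  · have := this (v := -v) (d := -d) (fun p t => by
      rw [show p + t • -v = p + (-t) • v by module, hv]
      ring) (by linarith)
    linarith
  by_contra hne
  have hd' : d < 0 := lt_of_le_of_ne hd hne
  set p := devExtension dev z with hp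
  have hp0 : q (hat p) = 0 := LiftedSubconic.form_eq_zero hdev hU hz
  -- The points start one step away from `p`, which itself is on the boundary. As the form decreases
  -- along `v`, a radius that works for the first point works for all.
  have hmem : ∀ k : ℕ, p + ((k : ℝ) + 1) • v ∈ conicSublevel q := by
    intro k
    change q _ < 0
    rw [hv, hp0, zero_add]
    exact mul_neg_of_pos_of_neg (by positivity) hd'
  obtain ⟨ε, hε, hball⟩ := Metric.isOpen_iff.1 (isOpen_conicSublevel q) _ (hmem 0)
  have hball' : ∀ k : ℕ, Metric.ball (p + ((k : ℝ) + 1) • v) ε ⊆ conicSublevel q := by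
    intro k x hx
    have h1 : x - (k : ℝ) • v ∈ Metric.ball (p + (((0 : ℕ) : ℝ) + 1) • v) ε := by
      rw [Metric.mem_ball, dist_eq_norm] at hx ⊢
      convert hx using 2
      push_cast
      module
    have h2 : q (hat (x - (k : ℝ) • v)) < 0 := hball h1
    have h3 : q (hat x) = q (hat (x - (k : ℝ) • v)) + k * d := by
      rw [← hv]
      congr 2
      module
    change q _ < 0
    rw [h3]
    have : (k : ℝ) * d ≤ 0 := mul_nonpos_of_nonneg_of_nonpos (by positivity) hd
    linarith
  have hu : ∀ k : ℕ, ∃ u ∈ U.carrier, dev u = p + ((k : ℝ) + 1) • v := by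
    intro k
    have := hmem k
    rw [← hU] at this
    exact this
  choose u huU hu using hu
  obtain ⟨n, m, hnm, φ, w, hφ, hlt⟩ := hrec u ε hε
  have hφU : φ (u m) ∈ U.carrier :=
    U.convex.mem_of_flatDist_lt hdev U.isOpen_image (huU n)
      (by rw [hu, hU]; exact hball' n) hlt
  have ho : IsOpen (dev '' (φ '' U.carrier)) := by
    rw [hφ.image_image]
    exact (Homeomorph.addRight w).isOpenMap _ U.isOpen_image
  refine LiftedSubconic.devExtension_notMem hdev hz (hφ.isConvexSubset hdev U.convex) ho hφU
    (mem_image_of_mem _ (huU m)) ?_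
  rw [hφ.mem_image_iff, hU]
  -- With `m = n + k + 1`, the point `p - w` is within `ε` of `p + (k + 1) • v`. So `p` is developed
  -- into the translate of the subconic, which is forbidden for a cone point.
  obtain ⟨k, rfl⟩ := Nat.exists_eq_add_of_lt hnm
  refine hball' k ?_
  have h1 := (hdev.dist_le _ _).trans_lt hlt
  rw [hφ, hu, hu, dist_eq_norm] at h1
  rw [Metric.mem_ball, dist_eq_norm]
  refine lt_of_eq_of_lt (congrArg norm ?_) h1
  push_cast
  module

/-- A subconic with many cone points that is not an ellipse is a strip with a period. -/
theorem LiftedSubconic.IsRich.exists_periodic_strip (hR : U.IsRich) (hrec : HasRecurrence dev)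
    (hdev : IsDevelopingMap dev) (hq : IsNontrivialForm q)
    (hU : dev '' U.carrier = conicSublevel q) (hnd : ¬ ∀ v ≠ 0, 0 < q (dirVec v)) :
    ∃ z₀ ∈ U.conePoints, ∃ z₁ ∈ U.conePoints, ∃ (e n : Plane) (c : ℝ),
      devExtension dev z₁ = devExtension dev z₀ + n ∧ planeDet e n ≠ 0 ∧ 0 < c ∧
      (∀ s y : ℝ, q (hat (devExtension dev z₀ + s • e + y • n)) = c * (y * (y - 1))) ∧
      ∃ φ : X ≃ₜ X, IsDevShift dev φ e ∧ φ '' U.carrier = U.carrier := by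
  push Not at hnd
  obtain ⟨v, hv0, hv⟩ := hnd
  have hpsd := U.form_dirVec_nonneg hdev hq hU
  obtain ⟨d, hd⟩ := exists_slope_of_isotropic hpsd (le_antisymm hv (hpsd v))
  obtain ⟨z₀, hz₀, z₁, hz₁, hdet⟩ := hR.exists_planeDet_ne_zero hdev hv0
  have hd0 := LiftedSubconic.slope_eq_zero hrec hdev hU hz₀ hd
  simp only [hd0, mul_zero, add_zero] at hd
  set p := devExtension dev z₀ with hp
  set n := devExtension dev z₁ - p with hn
  have hz₁' : devExtension dev z₁ = p + n := by rw [hn]; module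
  have hp0 : q (hat p) = 0 := LiftedSubconic.form_eq_zero hdev hU hz₀
  have hp1 : q (hat (p + n)) = 0 := hz₁' ▸ LiftedSubconic.form_eq_zero hdev hU hz₁
  set c := q (dirVec n) with hc
  have hstrip : ∀ s y : ℝ, q (hat (p + s • v + y • n)) = c * (y * (y - 1)) := by
    intro s y
    have h1 := form_line q p n 1
    rw [one_smul, hp1, hp0] at h1
    rw [show p + s • v + y • n = p + y • n + s • v by module, hd, form_line, hp0]
    linear_combination (-y) * h1
  have hcpos : 0 < c := by
    refine lt_of_le_of_ne (hpsd n) fun h0 => ?_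
    obtain ⟨o, ho⟩ := hq.1
    obtain ⟨s, y, hsy⟩ := exists_frame_coords hdet (o - p)
    have h1 : q (hat o) < 0 := ho
    rw [show o = p + s • v + y • n by rw [add_assoc, ← hsy]; module, hstrip, ← h0] at h1
    linarith
  have hmid : ∀ k : ℕ, p + (k : ℝ) • v + (1 / 2 : ℝ) • n ∈ conicSublevel q := by
    intro k
    change q _ < 0
    rw [hstrip]
    linarith
  obtain ⟨ε₀, hε₀, hball⟩ := Metric.isOpen_iff.1 (isOpen_conicSublevel q) _ (hmid 0)
  have hball' : ∀ k : ℕ, Metric.ball (p + (k : ℝ) • v + (1 / 2 : ℝ) • n) ε₀ ⊆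
      conicSublevel q := by
    intro k x hx
    have h1 : x + (-(k : ℝ)) • v ∈
        Metric.ball (p + ((0 : ℕ) : ℝ) • v + (1 / 2 : ℝ) • n) ε₀ := by
      rw [Metric.mem_ball, dist_eq_norm] at hx ⊢
      convert hx using 2
      push_cast
      module
    have h2 : q (hat (x + (-(k : ℝ)) • v)) < 0 := hball h1
    rw [hd] at h2
    exact h2
  have hu : ∀ k : ℕ, ∃ u ∈ U.carrier, dev u = p + (k : ℝ) • v + (1 / 2 : ℝ) • n := by
    intro k
    have := hmid k
    rw [← hU] at this
    exact this
  choose u huU hu using hu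
  -- The bound `ε₀` makes the translate meet the subconic; the bound `‖v‖` will exclude the zero
  -- translation.
  obtain ⟨i, j, hij, φ, w, hφ, hlt⟩ := hrec u (min ε₀ ‖v‖) (lt_min hε₀ (norm_pos_iff.2 hv0))
  have hφU : φ (u j) ∈ U.carrier :=
    U.convex.mem_of_flatDist_lt hdev U.isOpen_image (huU i)
      (by rw [hu, hU]; exact hball' i) (hlt.trans_le (min_le_left _ _))
  have ho : IsOpen (dev '' (φ '' U.carrier)) := by
    rw [hφ.image_image]
    exact (Homeomorph.addRight w).isOpenMap _ U.isOpen_image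
  have hcv := hφ.isConvexSubset hdev U.convex
  obtain ⟨α, β, hw⟩ := exists_frame_coords hdet w
  have hnot₀ := LiftedSubconic.devExtension_notMem hdev hz₀ hcv ho hφU
    (mem_image_of_mem _ (huU j))
  have hnot₁ := LiftedSubconic.devExtension_notMem hdev hz₁ hcv ho hφU
    (mem_image_of_mem _ (huU j))
  rw [hφ.mem_image_iff, hU] at hnot₀ hnot₁
  have h0 : 0 ≤ c * (-β * (-β - 1)) := by
    have h1 : 0 ≤ q (hat (p - w)) := not_lt.1 hnot₀
    rwa [show p - w = p + (-α) • v + (-β) • n by rw [hw]; module, hstrip] at h1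
  have h1 : 0 ≤ c * ((1 - β) * (1 - β - 1)) := by
    have h1 : 0 ≤ q (hat (devExtension dev z₁ - w)) := not_lt.1 hnot₁
    rwa [hz₁', show p + n - w = p + (-α) • v + (1 - β) • n by rw [hw]; module, hstrip] at h1
  have h2 : c * ((1 / 2 + β) * (1 / 2 + β - 1)) < 0 := by
    have h1 : dev (φ (u j)) ∈ conicSublevel q := hU ▸ mem_image_of_mem _ hφU
    have h2 : q (hat (dev (φ (u j)))) < 0 := h1
    rwa [hφ, hu, show p + (j : ℝ) • v + (1 / 2 : ℝ) • n + w =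
      p + ((j : ℝ) + α) • v + (1 / 2 + β) • n by rw [hw]; module, hstrip] at h2
  -- Neither cone point enters the translated strip, so `-β` and `1 - β` are outside `(0, 1)`, while
  -- the overlap puts `1 / 2 + β` inside: the translation is along the strip.
  have hβ : β = 0 := by
    have h0' := nonneg_of_mul_nonneg_right h0 hcpos
    have h1' := nonneg_of_mul_nonneg_right h1 hcpos
    have h2' : (1 / 2 + β) * (1 / 2 + β - 1) < 0 := by
      by_contra h3
      exact absurd h2 (not_lt.2 (mul_nonneg hcpos.le (not_lt.1 h3)))
    nlinarith
  have hw' : w = α • v := by rw [hw, hβ]; module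
  have hα : α ≠ 0 := by
    rintro rfl
    have h3 := (hdev.dist_le _ _).trans_lt (hlt.trans_le (min_le_right _ _))
    rw [hφ, hu, hu, dist_eq_norm, hw'] at h3
    rw [show p + (i : ℝ) • v + (1 / 2 : ℝ) • n - (p + (j : ℝ) • v + (1 / 2 : ℝ) • n + (0 : ℝ) • v) =
      ((i : ℝ) - j) • v by module, norm_smul] at h3
    have h4 : 1 ≤ ‖(i : ℝ) - j‖ := by
      have : (i : ℝ) + 1 ≤ j := by exact_mod_cast hij
      rw [Real.norm_eq_abs, abs_sub_comm]
      exact le_trans (by linarith) (le_abs_self _)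
    nlinarith [norm_nonneg v]
  refine ⟨z₀, hz₀, z₁, hz₁, α • v, n, c, hz₁', ?_, hcpos, fun s y => ?_, φ, hw' ▸ hφ, ?_⟩
  · have := planeDet_comb v n α 0 0 1
    rw [zero_smul, add_zero, zero_smul, zero_add, one_smul] at this
    rw [this]
    simpa using ⟨hα, hdet⟩
  · rw [smul_smul]
    exact hstrip _ y
  -- A translation along `v` preserves the planar strip, and two convex sets with the same image and
  -- a common point are equal.
  · refine hcv.eq_of_image_eq U.convex hdev (mem_image_of_mem _ (huU j)) hφU ?_
    ext x
    rw [hφ.mem_image_iff, hU]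
    change q _ < 0 ↔ q _ < 0
    rw [show x - w = x + (-α) • v by rw [hw']; module, hd]

end Shape

/-! ### Subconics with many cone points are isolated -/

section Isolation

variable {X : Type*} [TopologicalSpace X] [ChartedSpace Plane X]
  {dev : X → Plane} {U V : LiftedSubconic dev} {q : Form3}

theorem LiftedSubconic.ext_carrier (h : U.carrier = V.carrier) : U = V := by
  cases U
  cases V
  simpa using h

theorem LiftedSubconic.isOpen_setOf_mem (x : X) :
    IsOpen {V : LiftedSubconic dev | x ∈ V.carrier} :=
  (inf_le_right : LiftedSubconic.topology dev ≤ _) _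
    (TopologicalSpace.isOpen_generateFrom_of_mem ⟨x, rfl⟩)

theorem LiftedSubconic.continuous_develop :
    Continuous (LiftedSubconic.develop : LiftedSubconic dev → PlanarSubconic) :=
  continuous_iff_le_induced.2 inf_le_left

theorem IsPreconnected.inter_frontier_nonempty {α : Type*} [TopologicalSpace α] {t s : Set α}
    (ht : IsPreconnected t) (h : (t ∩ s).Nonempty) (h' : (t ∩ sᶜ).Nonempty) :
    (t ∩ frontier s).Nonempty := by
  by_contra hne
  have hf : ∀ x ∈ t, x ∉ frontier s := fun x hx hxf => hne ⟨x, hx, hxf⟩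
  obtain ⟨x, hx, hxs⟩ := h
  obtain ⟨y, hy, hys⟩ := h'
  obtain ⟨w, -, hw, hw'⟩ := ht (interior s) (closure s)ᶜ isOpen_interior isClosed_closure.isOpen_compl
    (fun w hw => or_iff_not_imp_left.2 fun h1 h2 => hf w hw ⟨h2, h1⟩)
    ⟨x, hx, by_contra fun h1 => hf x hx ⟨subset_closure hxs, h1⟩⟩
    ⟨y, hy, fun h1 => hf y hy ⟨h1, fun h2 => hys (interior_subset h2)⟩⟩
  exact hw' (subset_closure (interior_subset hw))

theorem exists_injective_fin_of_le_encard {α : Type*} {s : Set α} {k : ℕ}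
    (h : (k : ℕ∞) ≤ s.encard) : ∃ f : Fin k → α, Function.Injective f ∧ ∀ i, f i ∈ s := by
  obtain ⟨t, hts, ht⟩ := exists_subset_encard_eq h
  have hfin : t.Finite := finite_of_encard_eq_coe ht
  have hcard : hfin.toFinset.card = k := by
    rw [hfin.encard_eq_coe_toFinset_card] at ht
    exact_mod_cast ht
  let g := (Finset.equivFinOfCardEq hcard).symm
  exact ⟨fun i => g i, Subtype.val_injective.comp g.injective,
    fun i => hts (hfin.mem_toFinset.1 (g i).2)⟩

theorem IsDevShift.exists_zsmul {φ : X ≃ₜ X} {e : Plane} (hφ : IsDevShift dev φ e)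
    {S : Set X} (hS : φ '' S = S) (m : ℤ) :
    ∃ ψ : X ≃ₜ X, IsDevShift dev ψ ((m : ℝ) • e) ∧ ψ '' S = S := by
  have hnat : ∀ k : ℕ, ∃ ψ : X ≃ₜ X, IsDevShift dev ψ ((k : ℝ) • e) ∧ ψ '' S = S := by
    intro k
    induction k with
    | zero => exact ⟨Homeomorph.refl X, fun x => by simp, by simp⟩
    | succ k ih =>
      obtain ⟨ψ, h1, h2⟩ := ih
      refine ⟨ψ.trans φ, ?_, ?_⟩
      · convert h1.trans hφ using 1
        push_cast
        module
      · change (φ ∘ ψ) '' S = S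
        rw [image_comp, h2, hS]
  obtain ⟨k, rfl | rfl⟩ := m.eq_nat_or_neg
  · exact_mod_cast hnat k
  · obtain ⟨ψ, h1, h2⟩ := hnat k
    refine ⟨ψ.symm, ?_, ?_⟩
    · convert h1.symm using 1
      push_cast
      module
    · conv_lhs => rw [← h2]
      rw [← image_comp]
      simp

variable [TranslationSurface X]

/-- One half of `δ` is for the passage from the cone point to a point of `V`, the other for the
passage from there to `U`. -/
theorem LiftedSubconic.conePoints_subset_of_near {δ : ℝ}
    (hδ : 0 < δ) (hnear : ∀ z ∈ surfaceFrontier X, ∀ u ∈ U.carrier,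
      dist z (toFlatCompletion X u) < δ → z ∈ flatClosure U.carrier)
    (h : ∀ v ∈ V.carrier, ∃ u ∈ U.carrier, flatDist v u < δ / 2) :
    V.conePoints ⊆ U.conePoints := by
  rw [conePoints_eq, conePoints_eq]
  rintro z ⟨hz, hzF⟩
  refine ⟨?_, hzF⟩
  obtain ⟨v, hv, hzv⟩ := exists_flatDist_lt_of_mem_flatClosure hz (half_pos hδ)
  obtain ⟨u, hu, hvu⟩ := h v hv
  refine hnear z hzF u hu ((dist_triangle _ (toFlatCompletion X v) _).trans_lt ?_)
  rw [dist_toFlatCompletion]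
  linarith

theorem LiftedSubconic.eq_of_five_cone_points (hdev : IsDevelopingMap dev) {q' : Form3}
    (hdef : ∀ v ≠ 0, 0 < q (dirVec v)) (hU : dev '' U.carrier = conicSublevel q)
    (hV : dev '' V.carrier = conicSublevel q') {a : X} (haU : a ∈ U.carrier)
    (haV : a ∈ V.carrier) {f : Fin 5 → FlatCompletion X} (hf : Function.Injective f)
    (hfU : ∀ i, f i ∈ U.conePoints) (hfV : ∀ i, f i ∈ V.conePoints) : V = U := by
  have heq : conicSublevel q = conicSublevel q' := by
    refine conicSublevel_eq_of_five_points hdef (P := fun i => devExtension dev (f i))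
      (fun i j hij => hf (U.injOn_devExtension hdev (hfU i) (hfU j) hij))
      (fun i => LiftedSubconic.form_eq_zero hdev hU (hfU i))
      (fun i => LiftedSubconic.form_eq_zero hdev hV (hfV i)) (o := dev a)
      (hU ▸ mem_image_of_mem _ haU) (hV ▸ mem_image_of_mem _ haV)
  exact LiftedSubconic.ext_carrier
    (V.convex.eq_of_image_eq U.convex hdev haV haU (by rw [hU, hV, heq]))

/-- Let `C` be the ellipse and `o` the development of a point `x₀` of `U`. The neighbourhood asks
that `V` contain `x₀` and that the closure of its development miss the boundary of a slightly
dilated copy of `C`. Being connected, the development of `V` then stays in the dilated copy, so cone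
points of `V` are cone points of `U`, and five of them determine the conic. -/
theorem LiftedSubconic.exists_isolating_of_definite (hdev : IsDevelopingMap dev)
    (hF : IsDiscrete (surfaceFrontier X)) (hU : dev '' U.carrier = conicSublevel q)
    (hdef : ∀ v ≠ 0, 0 < q (dirVec v)) :
    ∃ O : Set (LiftedSubconic dev), IsOpen O ∧ U ∈ O ∧ ∀ V ∈ O, V.IsRich → V = U := by
  have hb : Bornology.IsBounded (dev '' U.carrier) :=
    hU ▸ isBounded_conicSublevel_of_definite hdef
  obtain ⟨δ, hδ, hnear⟩ := U.convex.exists_pos_forall_frontier hdev hF Subset.rfl hb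
  obtain ⟨x₀, hx₀⟩ := U.nonempty
  set C := dev '' U.carrier with hC
  have hCo : IsOpen C := U.isOpen_image
  have hCc : Convex ℝ C := U.convex.convex_image hdev
  set o := dev x₀ with ho
  have hoC : o ∈ C := mem_image_of_mem _ hx₀
  obtain ⟨R, hR, hCR⟩ := hb.subset_ball_lt 0 o
  -- Dilation about `o` by `1 + η` moves points of `C` by less than `η * R = δ / 2`.
  set η := δ / (2 * R) with hη
  have hηpos : 0 < η := by positivity
  have hηR : η * R = δ / 2 := by rw [hη]; field_simp
  set h : Plane → Plane := fun x => o + (1 + η) • (x - o) with hh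
  set g : Plane → Plane := fun x => o + (1 + η)⁻¹ • (x - o) with hg
  have h1η : 1 + η ≠ 0 := by positivity
  have hhg : ∀ x, h (g x) = x := by
    intro x
    simp only [hh, hg, add_sub_cancel_left, smul_smul, mul_inv_cancel₀ h1η]
    module
  have hgh : ∀ x, g (h x) = x := by
    intro x
    simp only [hh, hg, add_sub_cancel_left, smul_smul, inv_mul_cancel₀ h1η]
    module
  have hinv0 : 0 < (1 + η)⁻¹ := by positivity
  have hinv1 : (1 + η)⁻¹ < 1 := inv_lt_one_of_one_lt₀ (by linarith)
  have hgcomb : ∀ x, g x = (1 - (1 + η)⁻¹) • o + (1 + η)⁻¹ • x := by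
    intro x
    simp only [hg]
    module
  have hcont : Continuous h := by fun_prop
  have hgcont : Continuous g := by fun_prop
  have hK : IsCompact (h '' frontier C) :=
    (hb.isCompact_closure.of_isClosed_subset isClosed_frontier frontier_subset_closure).image hcont
  refine ⟨{V | x₀ ∈ V.carrier} ∩ LiftedSubconic.develop ⁻¹'
    {D : PlanarSubconic | Disjoint (h '' frontier C) (closure D.1)},
    (LiftedSubconic.isOpen_setOf_mem x₀).inter
      ((PlanarSubconic.isOpen_setOf_disjoint_closure hK).preimage
        LiftedSubconic.continuous_develop), ⟨hx₀, ?_⟩, ?_⟩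
  · refine disjoint_left.2 ?_
    rintro _ ⟨x, hx, rfl⟩ hcl
    have h1 : g (h x) ∈ interior C := by
      rw [hgcomb]
      exact hCc.combo_interior_closure_mem_interior (hCo.interior_eq.symm ▸ hoC) hcl
        (by linarith) hinv0.le (by ring)
    rw [hgh] at h1
    exact hx.2 h1
  · rintro V ⟨hxV, hVK⟩ hVR
    have hxV' : x₀ ∈ V.carrier := hxV
    have hVc : Convex ℝ (dev '' V.carrier) := V.convex.convex_image hdev
    have hgo : g o = o := by simp [hg]
    have hgV : g '' (dev '' V.carrier) ⊆ C := by
      by_contra hns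
      obtain ⟨x, hx, hxC⟩ := not_subset.1 hns
      obtain ⟨y, ⟨y', hy', rfl⟩, hyf⟩ := IsPreconnected.inter_frontier_nonempty
        (hVc.isPreconnected.image g hgcont.continuousOn) (s := C)
        ⟨o, ⟨o, mem_image_of_mem _ hxV', hgo⟩, hoC⟩ ⟨x, hx, hxC⟩
      exact disjoint_left.1 hVK ⟨g y', hyf, hhg y'⟩ (subset_closure hy')
    have hsub : V.conePoints ⊆ U.conePoints := by
      refine LiftedSubconic.conePoints_subset_of_near hδ hnear fun v hv => ?_
      have hgvC : g (dev v) ∈ C := hgV (mem_image_of_mem _ (mem_image_of_mem _ hv))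
      -- The contracted point is on the segment from `o` to `dev v`, hence in the image of `V` as
      -- well; its distance to `v` can be measured inside the convex set `V`.
      have hgvV : g (dev v) ∈ dev '' V.carrier := by
        rw [hgcomb]
        exact hVc (mem_image_of_mem _ hxV') (mem_image_of_mem _ hv) (by linarith) hinv0.le
          (by ring)
      obtain ⟨u, hu, hug⟩ := hgvV
      refine ⟨u, V.convex.mem_of_dev_mem U.convex hdev hxV' hx₀ hu (hug ▸ hgvC), ?_⟩
      rw [V.convex.flatDist_eq hdev hv hu, hug, dist_eq_norm]
      have h1 : dev v - g (dev v) = η • (g (dev v) - o) := by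
        conv_lhs => rw [← hhg (dev v)]
        rw [hgh]
        simp only [hh]
        module
      have h2 : ‖g (dev v) - o‖ < R := by
        have := hCR hgvC
        rwa [Metric.mem_ball, dist_eq_norm] at this
      rw [h1, norm_smul, Real.norm_of_nonneg hηpos.le, ← hηR]
      exact mul_lt_mul_of_pos_left h2 hηpos
    obtain ⟨q', -, hV⟩ := V.isSubconic
    obtain ⟨f, hf, hfV⟩ := exists_injective_fin_of_le_encard hVR.1
    exact LiftedSubconic.eq_of_five_cone_points hdev hdef (hC ▸ hU) hV hx₀ hxV' hf
      (fun i => hsub (hfV i)) hfV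

theorem three_roots_absurd {a β γ x y z : ℝ} (ha : a ≠ 0) (hxy : x ≠ y) (hxz : x ≠ z)
    (hyz : y ≠ z) (hx : a * x ^ 2 + β * x + γ = 0) (hy : a * y ^ 2 + β * y + γ = 0)
    (hz : a * z ^ 2 + β * z + γ = 0) : False := by
  have h1 : (x - y) * (a * (x + y) + β) = 0 := by linear_combination hx - hy
  have h2 : (x - z) * (a * (x + z) + β) = 0 := by linear_combination hx - hz
  have h3 := (mul_eq_zero.1 h1).resolve_left (sub_ne_zero.2 hxy)
  have h4 := (mul_eq_zero.1 h2).resolve_left (sub_ne_zero.2 hxz)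
  have h5 : a * (y - z) = 0 := by linear_combination h3 - h4
  exact (mul_eq_zero.1 h5).elim ha (sub_ne_zero.2 hyz)

/-- A conic that passes through five points of two parallel lines has a vanishing quadratic
coefficient in the direction of the lines. -/
theorem coeff_eq_zero_of_five_points {a b c d k f : ℝ} {s y : Fin 5 → ℝ}
    (hinj : Function.Injective fun i => (s i, y i)) (hy : ∀ i, y i = 0 ∨ y i = 1)
    (h : ∀ i, quadPoly a b c d k f (s i) (y i) = 0) : a = 0 := by
  by_contra ha
  -- Three of the five points lie on one line, where the polynomial is quadratic in `s` with leading
  -- coefficient `a`.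
  obtain ⟨t, -, ht⟩ := Finset.exists_lt_card_fiber_of_mul_lt_card_of_maps_to
    (s := (Finset.univ : Finset (Fin 5))) (t := ({0, 1} : Finset ℝ)) (f := y) (n := 2)
    (fun i _ => by simpa using hy i)
    (by
      have : ({0, 1} : Finset ℝ).card ≤ 2 := Finset.card_le_two
      rw [Finset.card_univ, Fintype.card_fin]
      omega)
  obtain ⟨i, hi, j, hj, l, hl, hij, hil, hjl⟩ := Finset.two_lt_card.1 ht
  simp only [Finset.mem_filter, Finset.mem_univ, true_and] at hi hj hl
  have hne : ∀ i j, i ≠ j → y i = t → y j = t → s i ≠ s j := fun i j hij h1 h2 h3 =>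
    hij (hinj (Prod.ext h3 (h1.trans h2.symm)))
  have hroot : ∀ i, y i = t → a * s i ^ 2 + (b * t + d) * s i + (c * t ^ 2 + k * t + f) = 0 := by
    rintro i rfl
    have := h i
    rw [quadPoly] at this
    linear_combination this
  exact three_roots_absurd ha (hne i j hij hi hj) (hne i l hil hi hl) (hne j l hjl hj hl)
    (hroot i hi) (hroot j hj) (hroot l hl)

theorem slope_eq_zero_of_forall_int {d f : ℝ} (h : ∀ m : ℤ, 0 ≤ d * m + f) : d = 0 := by
  by_contra hd
  obtain ⟨N, hN⟩ := exists_nat_gt (f / |d|)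
  have hd' : 0 < |d| := abs_pos.2 hd
  rw [div_lt_iff₀ hd'] at hN
  rcases abs_cases d with ⟨h1, _⟩ | ⟨h1, _⟩
  · have := h (-(N : ℤ))
    push_cast at this
    rw [h1] at hN
    linarith
  · have := h N
    push_cast at this
    rw [h1] at hN
    linarith

/-- A quadratic polynomial with two roots outside `(0, 1)` that is negative at `1 / 4` and not
negative at `0` and `1`. -/
theorem quadratic_eq_of_roots {c k f y y' : ℝ} (hyy : y < y') (hy : c * y ^ 2 + k * y + f = 0)
    (hy' : c * y' ^ 2 + k * y' + f = 0) (h0 : 0 ≤ f) (h1 : 0 ≤ c + k + f)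
    (h4 : c * (1 / 4) ^ 2 + k * (1 / 4) + f < 0) (hc : 0 ≤ c) (hyo : y ≤ 0 ∨ 1 ≤ y)
    (hyo' : y' ≤ 0 ∨ 1 ≤ y') : 0 < c ∧ k = -c ∧ f = 0 := by
  have hk : k = -c * (y + y') := by
    have : (y' - y) * (c * (y + y') + k) = 0 := by linear_combination hy' - hy
    have := (mul_eq_zero.1 this).resolve_left (by linarith)
    linarith
  have hf : f = c * (y * y') := by
    rw [hk] at hy
    linear_combination hy
  have hc0 : 0 < c := by
    refine lt_of_le_of_ne hc fun h => ?_
    rw [hf, hk, ← h] at h4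
    norm_num at h4
  have h5 : (1 / 4 - y) * (1 / 4 - y') < 0 := by
    have : c * ((1 / 4 - y) * (1 / 4 - y')) < 0 := by
      rw [hk, hf] at h4
      linarith
    by_contra h6
    exact absurd this (not_lt.2 (mul_nonneg hc (not_lt.1 h6)))
  have h6 : 0 < 1 / 4 - y ∧ 1 / 4 - y' < 0 := by
    rcases mul_neg_iff.1 h5 with h | h
    · exact h
    · exact absurd hyy (by linarith)
  have h7 : y ≤ 0 := hyo.resolve_right (by linarith)
  have h8 : 1 ≤ y' := hyo'.resolve_left (by linarith)
  have h9 : 0 ≤ y * y' := nonneg_of_mul_nonneg_right (hf ▸ h0) hc0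
  have h10 : 0 ≤ (1 - y) * (1 - y') := by
    refine nonneg_of_mul_nonneg_right (a := c) ?_ hc0
    rw [hk, hf] at h1
    linarith
  have h11 : y = 0 := le_antisymm h7 (nonneg_of_mul_nonneg_left h9 (by linarith))
  have h12 : y' = 1 := by
    have : 0 ≤ 1 - y' := nonneg_of_mul_nonneg_right h10 (by linarith)
    linarith
  refine ⟨hc0, ?_, ?_⟩
  · rw [hk, h11, h12]
    ring
  · rw [hf, h11]
    ring

end Isolation

/-! ### Isolation of periodic strips -/

section StripIsolation

variable {X : Type*} [TopologicalSpace X] [ChartedSpace Plane X] [TranslationSurface X]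
  {dev : X → Plane} {U V : LiftedSubconic dev} {q : Form3} {φ : X ≃ₜ X} {w : Plane}

theorem IsDevShift.flatMap_mem_conePoints (h : IsDevShift dev φ w) (hdev : IsDevelopingMap dev)
    (hUV : φ '' U.carrier = V.carrier) {z : FlatCompletion X} (hz : z ∈ U.conePoints) :
    flatMap φ z ∈ V.conePoints := by
  rw [conePoints_eq] at hz ⊢
  exact ⟨hUV ▸ h.flatMap_mem_flatClosure hdev hz.1, h.flatMap_mem_surfaceFrontier hdev hz.2⟩

/-- Near a strip with a period, every point of the frontier is a cone point of the strip. -/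
theorem LiftedSubconic.exists_pos_of_periodic_strip (hdev : IsDevelopingMap dev)
    (hF : IsDiscrete (surfaceFrontier X)) (hU : dev '' U.carrier = conicSublevel q)
    {p e n : Plane} {c : ℝ} (hdet : planeDet e n ≠ 0) (hc : 0 < c)
    (hq : ∀ s y : ℝ, q (hat (p + s • e + y • n)) = c * (y * (y - 1)))
    (hφ : IsDevShift dev φ e) (hφU : φ '' U.carrier = U.carrier) :
    ∃ δ > 0, ∀ z ∈ surfaceFrontier X, ∀ u ∈ U.carrier,
      dist z (toFlatCompletion X u) < δ → z ∈ flatClosure U.carrier := by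
  -- A fundamental parallelogram for the period `e`: the part of the strip over it is bounded, so it
  -- has a uniform `δ`, and powers of `φ` carry this `δ` to the whole strip.
  let K : Set Plane := (fun t : ℝ × ℝ => p + t.1 • e + t.2 • n) '' (Icc 0 1 ×ˢ Icc 0 1)
  have hK : IsCompact K := (isCompact_Icc.prod isCompact_Icc).image (by fun_prop)
  obtain ⟨δ, hδ, hnear⟩ := U.convex.exists_pos_forall_frontier hdev hF
    (S := U.carrier ∩ dev ⁻¹' K) inter_subset_left
    (hK.isBounded.subset (by rintro _ ⟨u, hu, rfl⟩; exact hu.2))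
  refine ⟨δ, hδ, fun z hz u hu hzu => ?_⟩
  obtain ⟨s, y, hsy⟩ := exists_frame_coords hdet (dev u - p)
  have hu' : dev u = p + s • e + y • n := by rw [add_assoc, ← hsy]; module
  have hy : y * (y - 1) < 0 := by
    have h1 : dev u ∈ conicSublevel q := hU ▸ mem_image_of_mem _ hu
    have h2 : q (hat (dev u)) < 0 := h1
    rw [hu', hq] at h2
    exact neg_of_mul_neg_right h2 hc.le
  obtain ⟨ψ, hψ, hψU⟩ := hφ.exists_zsmul hφU (-⌊s⌋)
  have hψu : ψ u ∈ U.carrier ∩ dev ⁻¹' K := by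
    refine ⟨hψU ▸ mem_image_of_mem _ hu, (Int.fract s, y),
      ⟨⟨Int.fract_nonneg s, (Int.fract_lt_one s).le⟩, ?_, ?_⟩, ?_⟩
    · nlinarith
    · nlinarith
    · change p + Int.fract s • e + y • n = dev (ψ u)
      rw [hψ, hu', Int.fract]
      push_cast
      module
  have h1 : flatMap ψ z ∈ flatClosure (U.carrier ∩ dev ⁻¹' K) := by
    refine hnear _ (hψ.flatMap_mem_surfaceFrontier hdev hz) _ hψu ?_
    rwa [← hψ.flatMap_coe hdev, (hψ.isometry_flatMap hdev).dist_eq]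
  have h2 : flatMap ψ z ∈ flatClosure U.carrier :=
    closure_mono (image_mono inter_subset_left) h1
  have h3 := hψ.symm.flatMap_mem_flatClosure hdev h2
  rw [hψ.flatMap_symm_flatMap hdev] at h3
  convert h3 using 2
  conv_rhs => rw [← hψU]
  rw [← image_comp]
  simp

/-- Containing four well-chosen points is enough of a neighbourhood. Such a `V` meets `U`, so it
avoids the developed images of all translates of `z₀` and `z₁` by the period, that is, the integer
points of both boundary lines. It remains to separate conics curved along `e` from strips. -/
theorem LiftedSubconic.exists_isolating_of_strip (hdev : IsDevelopingMap dev)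
    (hF : IsDiscrete (surfaceFrontier X)) (hU : dev '' U.carrier = conicSublevel q)
    {z₀ z₁ : FlatCompletion X} (hz₀ : z₀ ∈ U.conePoints) (hz₁ : z₁ ∈ U.conePoints)
    {p e n : Plane} {c : ℝ} (hp₀ : devExtension dev z₀ = p) (hp₁ : devExtension dev z₁ = p + n)
    (hdet : planeDet e n ≠ 0) (hc : 0 < c)
    (hq : ∀ s y : ℝ, q (hat (p + s • e + y • n)) = c * (y * (y - 1)))
    (hφ : IsDevShift dev φ e) (hφU : φ '' U.carrier = U.carrier) :
    ∃ O : Set (LiftedSubconic dev), IsOpen O ∧ U ∈ O ∧ ∀ V ∈ O, V.IsRich → V = U := by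
  obtain ⟨δ, hδ, hnear⟩ :=
    LiftedSubconic.exists_pos_of_periodic_strip hdev hF hU hdet hc hq hφ hφU
  have hcoord : ∀ x : Plane, ∃ s y : ℝ, x = p + s • e + y • n := by
    intro x
    obtain ⟨s, y, h⟩ := exists_frame_coords hdet (x - p)
    exact ⟨s, y, by rw [add_assoc, ← h]; module⟩
  have hmem : ∀ s y : ℝ, p + s • e + y • n ∈ dev '' U.carrier ↔ y * (y - 1) < 0 := by
    intro s y
    rw [hU]
    change q _ < 0 ↔ _
    rw [hq]
    exact ⟨fun h => neg_of_mul_neg_right h hc.le, fun h => mul_neg_of_pos_of_neg hc h⟩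
  set r := ‖e‖ + ‖n‖ with hr
  have hr0 : 0 ≤ r := by positivity
  -- Displacements of at most `1 / L` in both frame coordinates then have norm below `δ / 2`.
  set L := 1 + 2 * r / δ with hL
  have hL1 : 1 ≤ L := by rw [hL]; linarith [div_nonneg (mul_nonneg zero_le_two hr0) hδ.le]
  have hLr : 1 / L * r < δ / 2 := by
    have h1 : L * δ = δ + 2 * r := by rw [hL]; field_simp
    rw [one_div, inv_mul_lt_iff₀ (by linarith)]
    linarith
  -- The ends of a long piece of the centre line, and two points above each other; these are the
  -- four negativity hypotheses of `quadPoly_near_strip`.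
  obtain ⟨u₁, hu₁, h₁⟩ := (hmem L (1 / 2)).2 (by norm_num)
  obtain ⟨u₂, hu₂, h₂⟩ := (hmem (-L) (1 / 2)).2 (by norm_num)
  obtain ⟨u₃, hu₃, h₃⟩ := (hmem 0 (1 / 4)).2 (by norm_num)
  obtain ⟨u₄, hu₄, h₄⟩ := (hmem 0 (3 / 4)).2 (by norm_num)
  refine ⟨{V | u₁ ∈ V.carrier} ∩ {V | u₂ ∈ V.carrier} ∩ {V | u₃ ∈ V.carrier} ∩
    {V | u₄ ∈ V.carrier}, (((LiftedSubconic.isOpen_setOf_mem u₁).inter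
      (LiftedSubconic.isOpen_setOf_mem u₂)).inter (LiftedSubconic.isOpen_setOf_mem u₃)).inter
      (LiftedSubconic.isOpen_setOf_mem u₄), ⟨⟨⟨hu₁, hu₂⟩, hu₃⟩, hu₄⟩, ?_⟩
  rintro V ⟨⟨⟨(hv₁ : u₁ ∈ V.carrier), (hv₂ : u₂ ∈ V.carrier)⟩, (hv₃ : u₃ ∈ V.carrier)⟩,
    (hv₄ : u₄ ∈ V.carrier)⟩ hVR
  obtain ⟨q', hq'nt, hV⟩ := V.isSubconic
  have hpsd := V.form_dirVec_nonneg hdev hq'nt hV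
  have hbc := polar_sq_le_of_nonneg hpsd e n
  have hform := form_frame_eq_quadPoly q' p e n
  have hconeV : ∀ z ∈ V.conePoints, q' (hat (devExtension dev z)) = 0 := fun z hz =>
    LiftedSubconic.form_eq_zero hdev hV hz
  set a := q' (dirVec e)
  set b := QuadraticMap.polar q' (dirVec e) (dirVec n)
  set c' := q' (dirVec n)
  set d := QuadraticMap.polar q' (hat p) (dirVec e)
  set k := QuadraticMap.polar q' (hat p) (dirVec n)
  set f := q' (hat p)
  have hmemV : ∀ s y : ℝ, p + s • e + y • n ∈ dev '' V.carrier ↔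
      quadPoly a b c' d k f s y < 0 := by
    intro s y
    rw [hV]
    change q' _ < 0 ↔ _
    rw [hform]
  have hneg : ∀ {u : X} {s y : ℝ}, u ∈ V.carrier → dev u = p + s • e + y • n →
      quadPoly a b c' d k f s y < 0 := fun hu h => (hmemV _ _).1 (h ▸ mem_image_of_mem _ hu)
  have hint : ∀ m : ℤ, p + (m : ℝ) • e + (0 : ℝ) • n ∉ dev '' V.carrier ∧
      p + (m : ℝ) • e + (1 : ℝ) • n ∉ dev '' V.carrier := by
    intro m
    obtain ⟨ψ, hψ, hψU⟩ := hφ.exists_zsmul hφU m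
    have key : ∀ z ∈ U.conePoints, devExtension dev z + (m : ℝ) • e ∉ dev '' V.carrier := by
      intro z hz
      rw [← hψ.devExtension_flatMap hdev]
      exact LiftedSubconic.devExtension_notMem hdev (hψ.flatMap_mem_conePoints hdev hψU hz)
        V.convex V.isOpen_image hu₁ hv₁
    refine ⟨?_, ?_⟩
    · have := key z₀ hz₀
      rwa [hp₀, ← add_zero (p + _), ← zero_smul ℝ n] at this
    · have := key z₁ hz₁
      rwa [hp₁, show p + n + (m : ℝ) • e = p + (m : ℝ) • e + (1 : ℝ) • n by module] at this
  have hZ0 : ∀ m : ℤ, 0 ≤ quadPoly a b c' d k f m 0 := fun m =>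
    not_lt.1 fun h => (hint m).1 ((hmemV _ _).2 h)
  have hZ1 : ∀ m : ℤ, 0 ≤ quadPoly a b c' d k f m 1 := fun m =>
    not_lt.1 fun h => (hint m).2 ((hmemV _ _).2 h)
  rcases (hpsd e).lt_or_eq with ha | ha
  -- Curved case: the cone points of `V` are cone points of `U`, so five of them lie on the two
  -- boundary lines and force `a = 0`.
  · exfalso
    have hsub : V.conePoints ⊆ U.conePoints := by
      refine LiftedSubconic.conePoints_subset_of_near hδ hnear fun v hv => ?_
      obtain ⟨s, y, hsy⟩ := hcoord (dev v)
      obtain ⟨s', y', hy0, hy1, hneg', hs', hy'⟩ := quadPoly_near_strip ha hL1 hbc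
        (hneg hv₁ h₁) (hneg hv₂ h₂) (hneg hv₃ h₃) (hneg hv₄ h₄) hZ0 hZ1 (hneg hv hsy)
      obtain ⟨u, hu, hu'⟩ := (hmemV _ _).2 hneg'
      refine ⟨u, V.convex.mem_of_dev_mem U.convex hdev hv₁ hu₁ hu (hu' ▸ (hmem _ _).2 ?_), ?_⟩
      · nlinarith
      · rw [V.convex.flatDist_eq hdev hv hu, hu', hsy, dist_eq_norm]
        refine lt_of_le_of_lt ?_ hLr
        rw [show p + s • e + y • n - (p + s' • e + y' • n) = (s - s') • e + (y - y') • n by module]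
        refine (norm_add_le _ _).trans ?_
        rw [norm_smul, norm_smul, Real.norm_eq_abs, Real.norm_eq_abs, hr, mul_add]
        gcongr
    obtain ⟨g, hg, hgV⟩ := exists_injective_fin_of_le_encard hVR.1
    choose s y hsy using fun i => hcoord (devExtension dev (g i))
    refine ha.ne' (coeff_eq_zero_of_five_points (s := s) (y := y) (b := b) (c := c') (d := d)
      (k := k) (f := f) (fun i j hij => hg (V.injOn_devExtension hdev (hgV i) (hgV j) ?_))
      (fun i => ?_) fun i => ?_)
    · obtain ⟨h1, h2⟩ := Prod.ext_iff.1 hij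
      rw [hsy, hsy, show s i = s j from h1, show y i = y j from h2]
    · have h1 := LiftedSubconic.form_eq_zero hdev hU (hsub (hgV i))
      rw [hsy, hq] at h1
      rcases mul_eq_zero.1 ((mul_eq_zero.1 h1).resolve_left hc.ne') with h | h
      · exact Or.inl h
      · exact Or.inr (by linarith)
    · rw [← hform, ← hsy]
      exact hconeV _ (hgV i)
  -- Flat case: `b` vanishes with `a`, and `d` vanishes because an affine function nonnegative on
  -- all integers is constant. The form depends on `y` alone, has two distinct roots by maximal
  -- span, both outside `(0, 1)` since cone points of `V` are not developed into `U`; the signs at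
  -- `0`, `1 / 4` and `1` make them `0` and `1`.
  · replace ha : a = 0 := ha.symm
    have hb : b = 0 := by
      rw [ha] at hbc
      exact pow_eq_zero_iff two_ne_zero |>.1 (le_antisymm (by linarith) (sq_nonneg b))
    have hd : d = 0 := slope_eq_zero_of_forall_int (f := f) fun m => by
      have := hZ0 m
      rw [quadPoly, ha, hb] at this
      linarith
    have hquad : ∀ s y, quadPoly a b c' d k f s y = c' * y ^ 2 + k * y + f := by
      intro s y
      rw [quadPoly, ha, hb, hd]
      ring
    have he : e ≠ 0 := by
      rintro rfl
      exact hdet (by simp [planeDet])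
    obtain ⟨z, hz, z', hz', hzz⟩ := hVR.exists_planeDet_ne_zero hdev he
    obtain ⟨s, y, hsy⟩ := hcoord (devExtension dev z)
    obtain ⟨s', y', hsy'⟩ := hcoord (devExtension dev z')
    have hne : y ≠ y' := by
      rintro rfl
      refine hzz ?_
      rw [hsy, hsy', show p + s' • e + y • n - (p + s • e + y • n) = (s' - s) • e + (0 : ℝ) • n
        by module]
      have := planeDet_comb e n 1 0 (s' - s) 0
      rw [one_smul, zero_smul, add_zero] at this
      rw [zero_smul, this]
      ring
    have hroot : ∀ z ∈ V.conePoints, ∀ s y : ℝ, devExtension dev z = p + s • e + y • n →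
        c' * y ^ 2 + k * y + f = 0 ∧ (y ≤ 0 ∨ 1 ≤ y) := by
      intro z hz s y h
      refine ⟨by rw [← hquad s y, ← hform, ← h]; exact hconeV z hz, ?_⟩
      have h1 := LiftedSubconic.devExtension_notMem hdev hz U.convex U.isOpen_image hv₁ hu₁
      rw [h, hmem] at h1
      by_contra! h2
      exact h1 (mul_neg_of_pos_of_neg h2.1 (by linarith [h2.2]))
    obtain ⟨hy, hyo⟩ := hroot z hz s y hsy
    obtain ⟨hy', hyo'⟩ := hroot z' hz' s' y' hsy'
    have h0 : 0 ≤ f := by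
      have := hZ0 0
      rw [hquad] at this
      linarith
    have h1 : 0 ≤ c' + k + f := by
      have := hZ1 0
      rw [hquad] at this
      linarith
    have h4 : c' * (1 / 4) ^ 2 + k * (1 / 4) + f < 0 := by
      rw [← hquad 0]
      exact hneg hv₃ h₃
    obtain ⟨hc', hk, hf⟩ : 0 < c' ∧ k = -c' ∧ f = 0 := by
      rcases hne.lt_or_gt with h | h
      · exact quadratic_eq_of_roots h hy hy' h0 h1 h4 (hpsd n) hyo hyo'
      · exact quadratic_eq_of_roots h hy' hy h0 h1 h4 (hpsd n) hyo' hyo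
    refine LiftedSubconic.ext_carrier (V.convex.eq_of_image_eq U.convex hdev hv₁ hu₁ ?_)
    ext x
    obtain ⟨s, y, rfl⟩ := hcoord x
    rw [hmem, hmemV, hquad, hk, hf, show c' * y ^ 2 + -c' * y + 0 = c' * (y * (y - 1)) by ring]
    exact ⟨fun h => neg_of_mul_neg_right h hc'.le, fun h => mul_neg_of_pos_of_neg hc' h⟩

/-- A subconic with many cone points has a neighborhood without other such subconics. -/
theorem LiftedSubconic.IsRich.exists_isolating (hR : U.IsRich) (hrec : HasRecurrence dev)
    (hdev : IsDevelopingMap dev) (hF : IsDiscrete (surfaceFrontier X)) :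
    ∃ O : Set (LiftedSubconic dev), IsOpen O ∧ U ∈ O ∧ ∀ V ∈ O, V.IsRich → V = U := by
  obtain ⟨q, hq, hU⟩ := U.isSubconic
  by_cases hdef : ∀ v ≠ 0, 0 < q (dirVec v)
  · exact LiftedSubconic.exists_isolating_of_definite hdev hF hU hdef
  · obtain ⟨z₀, hz₀, z₁, hz₁, e, n, c, hn, hdet, hc, hs, φ, hφ, hφU⟩ :=
      hR.exists_periodic_strip hrec hdev hq hU hdef
    exact LiftedSubconic.exists_isolating_of_strip hdev hF hU hz₀ hz₁ rfl hn hdet hc hs hφ hφU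

end StripIsolation

/-! ### The action of covering transformations on subconics -/

section Translate

/-- The linear map of `ℝ³` that extends the translation of the plane by `-w`. -/
def shearMap (w : Plane) : (Fin 3 → ℝ) →ₗ[ℝ] (Fin 3 → ℝ) :=
  LinearMap.id - (LinearMap.proj 2).smulRight (dirVec w)

theorem shearMap_hat (w p : Plane) : shearMap w (hat p) = hat (p - w) := by
  have h := hat_add (p - w) w
  rw [sub_add_cancel] at h
  change hat p - (1 : ℝ) • dirVec w = _
  rw [h, one_smul, add_sub_cancel_right]

theorem conicSublevel_comp_shearMap (q : Form3) (w : Plane) :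
    conicSublevel (q.comp (shearMap w)) = (fun p => p + w) '' conicSublevel q := by
  ext x
  rw [image_add_right, mem_preimage, ← sub_eq_add_neg]
  change q (shearMap w (hat x)) < 0 ↔ q _ < 0
  rw [shearMap_hat]

theorem IsNontrivialForm.comp_shearMap {q : Form3} (hq : IsNontrivialForm q) (w : Plane) :
    IsNontrivialForm (q.comp (shearMap w)) := by
  refine ⟨?_, fun h => hq.2 ?_⟩
  · rw [conicSublevel_comp_shearMap]
    exact hq.1.image _
  · rw [conicSublevel_comp_shearMap] at h
    refine eq_univ_of_forall fun x => ?_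
    obtain ⟨y, hy, hyx⟩ : x + w ∈ (fun p => p + w) '' conicSublevel q := h ▸ mem_univ _
    exact add_right_cancel hyx ▸ hy

/-- The translation of a planar subconic. -/
def PlanarSubconic.translate (w : Plane) (D : PlanarSubconic) : PlanarSubconic :=
  ⟨(fun p => p + w) '' D.1, by
    obtain ⟨q, hq, h⟩ := D.2
    exact ⟨q.comp (shearMap w), hq.comp_shearMap w, by rw [h, conicSublevel_comp_shearMap]⟩⟩

theorem PlanarSubconic.continuous_translate (w : Plane) :
    Continuous (PlanarSubconic.translate w) := by
  refine continuous_coinduced_dom.2 ?_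
  have h1 : Continuous fun q : Form3 => (q.comp (shearMap w) : Form3) :=
    continuous_induced_rng.2 (continuous_pi fun v => continuous_eval (shearMap w v))
  have h2 : PlanarSubconic.translate w ∘ PlanarSubconic.ofForm = PlanarSubconic.ofForm ∘
      fun q => ⟨q.1.comp (shearMap w), q.2.comp_shearMap w⟩ := by
    funext q
    exact Subtype.ext (conicSublevel_comp_shearMap q.1 w).symm
  rw [h2]
  exact continuous_coinduced_rng.comp ((h1.comp continuous_subtype_val).subtype_mk _)

theorem HasMaximalSpan.image_add_right {d : ℕ} {A : Set (EuclideanSpace ℝ (Fin d))}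
    (h : HasMaximalSpan A) (w : EuclideanSpace ℝ (Fin d)) :
    HasMaximalSpan ((fun p => p + w) '' A) := by
  obtain ⟨B, hB, hs⟩ := h
  refine ⟨(fun p => p + w) '' B, image_mono hB, ?_⟩
  have hset : {v | ∃ b ∈ (fun p => p + w) '' B, ∃ b' ∈ (fun p => p + w) '' B, v = b - b'} =
      {v | ∃ b ∈ B, ∃ b' ∈ B, v = b - b'} := by
    ext v
    simp only [exists_mem_image, add_sub_add_right_eq_sub, mem_ofPred_eq]
  rwa [hset, (add_left_injective w).encard_image]

end Translate

/-! ### Covering transformations acting on the space of subconics -/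

section Action

variable {X : Type*} [TopologicalSpace X] [ChartedSpace Plane X]
  {dev : X → Plane} {U V : LiftedSubconic dev} {φ : X ≃ₜ X} {w : Plane}

/-- The image of a subconic under a homeomorphism that is developed to a translation. -/
def LiftedSubconic.map (hdev : IsDevelopingMap dev) (hφ : IsDevShift dev φ w)
    (U : LiftedSubconic dev) : LiftedSubconic dev where
  carrier := φ '' U.carrier
  convex := hφ.isConvexSubset hdev U.convex
  isSubconic := by
    obtain ⟨q, hq, h⟩ := U.isSubconic
    exact ⟨q.comp (shearMap w), hq.comp_shearMap w,
      by rw [hφ.image_image, h, conicSublevel_comp_shearMap]⟩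

theorem LiftedSubconic.continuous_map (hdev : IsDevelopingMap dev) (hφ : IsDevShift dev φ w) :
    Continuous (LiftedSubconic.map hdev hφ) := by
  refine continuous_inf_rng.2 ⟨continuous_induced_rng.2 ?_, continuous_generateFrom_iff.2 ?_⟩
  · have h : LiftedSubconic.develop ∘ LiftedSubconic.map hdev hφ =
        PlanarSubconic.translate w ∘ LiftedSubconic.develop :=
      funext fun U => Subtype.ext (hφ.image_image U.carrier)
    rw [h]
    exact (PlanarSubconic.continuous_translate w).comp LiftedSubconic.continuous_develop
  · rintro _ ⟨x, rfl⟩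
    convert LiftedSubconic.isOpen_setOf_mem (dev := dev) (φ.symm x) using 1
    ext U
    exact mem_image_equiv (f := φ.toEquiv)

/-- Covering transformations act continuously on subconics, so the saturation of an open set is a
union of open preimages. -/
theorem isOpenMap_mk_deckSetoid {Z : Type*} [TopologicalSpace Z] [ChartedSpace Plane Z]
    [TranslationSurface X] {π : X → Z} (hπ : IsTranslationMap π) (hdev : IsDevelopingMap dev) :
    IsOpenMap (Quotient.mk (deckSetoid π dev)) := by
  intro O hO
  refine isOpen_coinduced.2 ?_
  refine isOpen_iff_forall_mem_open.2 ?_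
  rintro U ⟨V, hV, hVU⟩
  obtain ⟨φ, hφ, hUV⟩ := Quotient.exact hVU.symm
  obtain ⟨w, hw⟩ := hdev.exists_isDevShift hπ hφ
  have hmap : ∀ W, Quotient.mk (deckSetoid π dev) (LiftedSubconic.map hdev hw W) =
      Quotient.mk (deckSetoid π dev) W := by
    intro W
    refine (Quotient.sound ?_).symm
    exact ⟨φ, hφ, rfl⟩
  refine ⟨LiftedSubconic.map hdev hw ⁻¹' O, fun W hW => ⟨_, hW, hmap W⟩, hO.preimage (LiftedSubconic.continuous_map hdev hw), ?_⟩
  have : LiftedSubconic.map hdev hw U = V := LiftedSubconic.ext_carrier hUV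
  rwa [mem_preimage, this]

variable [TranslationSurface X]

theorem IsDevShift.conePoints_eq (h : IsDevShift dev φ w) (hdev : IsDevelopingMap dev)
    (hUV : φ '' U.carrier = V.carrier) : V.conePoints = flatMap φ '' U.conePoints := by
  refine Subset.antisymm (fun z hz => ?_) ?_
  · have hVU : φ.symm '' V.carrier = U.carrier := by
      rw [← hUV, ← image_comp]
      simp
    exact ⟨_, h.symm.flatMap_mem_conePoints hdev hVU hz, h.symm.flatMap_symm_flatMap hdev z⟩
  · rintro _ ⟨z, hz, rfl⟩
    exact h.flatMap_mem_conePoints hdev hUV hz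

theorem LiftedSubconic.IsRich.of_image_eq (hR : U.IsRich) (h : IsDevShift dev φ w)
    (hdev : IsDevelopingMap dev) (hUV : φ '' U.carrier = V.carrier) : V.IsRich := by
  have hcone := h.conePoints_eq hdev hUV
  refine ⟨?_, ?_⟩
  · rw [hcone, (h.isometry_flatMap hdev).injective.encard_image]
    exact hR.1
  · rw [hcone, image_image, image_congr fun z _ => h.devExtension_flatMap hdev z,
      ← image_image (fun p => p + w)]
    exact hR.2.image_add_right w

end Action

/-! ### Countability -/

section Countable

variable {X : Type*} [TopologicalSpace X] [ChartedSpace Plane X] [TranslationSurface X]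
  {dev : X → Plane} {U V : LiftedSubconic dev} {q : Form3}

theorem Set.countable_of_forall_exists {α κ : Type*} [Countable κ] {S : Set α} {R : α → κ → Prop}
    (h : ∀ x ∈ S, ∃ k, R x k) (h' : ∀ x ∈ S, ∀ y ∈ S, ∀ k, R x k → R y k → x = y) :
    S.Countable := by
  choose f hf using h
  refine countable_coe_iff.1 (Function.Injective.countable (f := fun x : S => f x x.2) ?_)
  intro x y hxy
  have hxy' : f x x.2 = f y y.2 := hxy
  exact Subtype.ext (h' x x.2 y y.2 _ (hf x x.2) (hxy' ▸ hf y y.2))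

/-- The completion is a separable metric space, hence second countable, and its discrete subsets are
countable. -/
theorem IsDevelopingMap.countable_surfaceFrontier (hdev : IsDevelopingMap dev)
    (hF : IsDiscrete (surfaceFrontier X)) : (surfaceFrontier X).Countable := by
  have := hdev.separableSpace_flatCompletion
  have := UniformSpace.secondCountable_of_separable (FlatCompletion X)
  have := hF.to_subtype
  exact (TopologicalSpace.separableSpace_iff_countable (α := surfaceFrontier X)).1 inferInstance

theorem LiftedSubconic.exists_mem_dense (U : LiftedSubconic dev) (hdev : IsDevelopingMap dev)
    {D : Set X} (hD : Dense D) : ∃ a ∈ D, a ∈ U.carrier := by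
  obtain ⟨a, ha, haD⟩ := hD.inter_open_nonempty _ (U.convex.isOpen hdev U.isOpen_image) U.nonempty
  exact ⟨a, haD, ha⟩

/-- The third cone point is the image of the first under the period, so that the direction of the
strip is also read off from cone points. -/
theorem LiftedSubconic.IsRich.exists_three_cone_points (hR : U.IsRich) (hrec : HasRecurrence dev)
    (hdev : IsDevelopingMap dev) (hq : IsNontrivialForm q)
    (hU : dev '' U.carrier = conicSublevel q) (hnd : ¬ ∀ v ≠ 0, 0 < q (dirVec v)) :
    ∃ z ∈ U.conePoints, ∃ z₁ ∈ U.conePoints, ∃ z₂ ∈ U.conePoints,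
      dev '' U.carrier = {x | ∃ s y : ℝ, 0 < y ∧ y < 1 ∧ x = devExtension dev z +
        s • (devExtension dev z₂ - devExtension dev z) +
        y • (devExtension dev z₁ - devExtension dev z)} := by
  obtain ⟨z₀, hz₀, z₁, hz₁, e, n, c, hn, hdet, hc, hs, φ, hφ, hφU⟩ :=
    hR.exists_periodic_strip hrec hdev hq hU hnd
  refine ⟨z₀, hz₀, z₁, hz₁, flatMap φ z₀, hφ.flatMap_mem_conePoints hdev hφU hz₀, ?_⟩
  rw [hφ.devExtension_flatMap hdev, hn, add_sub_cancel_left, add_sub_cancel_left, hU]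
  ext x
  obtain ⟨s, y, hsy⟩ := exists_frame_coords hdet (x - devExtension dev z₀)
  obtain rfl : x = devExtension dev z₀ + s • e + y • n := by
    rw [add_assoc, ← hsy]
    module
  have hiff : ∀ s y : ℝ, devExtension dev z₀ + s • e + y • n ∈ conicSublevel q ↔
      0 < y ∧ y < 1 := by
    intro s y
    change q _ < 0 ↔ _
    rw [hs]
    constructor
    · intro h
      have h1 : y * (y - 1) < 0 := neg_of_mul_neg_right h hc.le
      exact ⟨by nlinarith, by nlinarith⟩
    · rintro ⟨h0, h1⟩
      exact mul_neg_of_pos_of_neg hc (mul_neg_of_pos_of_neg h0 (by linarith))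
  constructor
  · intro h
    exact ⟨s, y, ((hiff s y).1 h).1, ((hiff s y).1 h).2, rfl⟩
  · rintro ⟨s', y', h0, h1, h⟩
    rw [h]
    exact (hiff s' y').2 ⟨h0, h1⟩

/-- A subconic is open, so it contains a point of a countable dense set, and this point singles out
one convex set over a given planar image. The image is encoded by five cone points of an ellipse or
three of a strip, from a countable frontier. -/
theorem countable_setOf_isRich (hrec : HasRecurrence dev) (hdev : IsDevelopingMap dev)
    (hF : IsDiscrete (surfaceFrontier X)) : {U : LiftedSubconic dev | U.IsRich}.Countable := by
  have hFc := (hdev.countable_surfaceFrontier hF).to_subtype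
  obtain ⟨D, hDc, hD⟩ := TopologicalSpace.exists_countable_dense X
  have hDc' := hDc.to_subtype
  have hcone : ∀ {U : LiftedSubconic dev} {z}, z ∈ U.conePoints → z ∈ surfaceFrontier X :=
    fun h => h.2
  let A : Set (LiftedSubconic dev) := {U | U.IsRich ∧ ∃ q : Form3,
    dev '' U.carrier = conicSublevel q ∧ ∀ v ≠ 0, 0 < q (dirVec v)}
  let B : Set (LiftedSubconic dev) := {U | U.IsRich ∧ ∃ q : Form3, IsNontrivialForm q ∧
    dev '' U.carrier = conicSublevel q ∧ ¬ ∀ v ≠ 0, 0 < q (dirVec v)}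
  have hA : A.Countable := by
    refine Set.countable_of_forall_exists (κ := D × (Fin 5 → surfaceFrontier X))
      (R := fun U k => (k.1 : X) ∈ U.carrier ∧ Function.Injective k.2 ∧
        ∀ i, (k.2 i : FlatCompletion X) ∈ U.conePoints) ?_ ?_
    · rintro U ⟨hR, -⟩
      obtain ⟨a, haD, haU⟩ := U.exists_mem_dense hdev hD
      obtain ⟨f, hf, hfU⟩ := exists_injective_fin_of_le_encard hR.1
      exact ⟨(⟨a, haD⟩, fun i => ⟨f i, hcone (hfU i)⟩), haU,
        fun i j hij => hf (congrArg Subtype.val hij), hfU⟩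
    · rintro V ⟨-, q', hV, -⟩ U ⟨-, q, hU, hdef⟩ k ⟨haV, hk, hkV⟩ ⟨haU, -, hkU⟩
      exact LiftedSubconic.eq_of_five_cone_points hdev hdef hU hV haU haV
        (Subtype.val_injective.comp hk) hkU hkV
  have hB : B.Countable := by
    refine Set.countable_of_forall_exists
      (κ := D × surfaceFrontier X × surfaceFrontier X × surfaceFrontier X)
      (R := fun U k => (k.1 : X) ∈ U.carrier ∧ dev '' U.carrier =
        {x | ∃ s y : ℝ, 0 < y ∧ y < 1 ∧ x = devExtension dev k.2.1 +
          s • (devExtension dev k.2.2.2 - devExtension dev k.2.1) +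
          y • (devExtension dev k.2.2.1 - devExtension dev k.2.1)}) ?_ ?_
    · rintro U ⟨hR, q, hq, hU, hnd⟩
      obtain ⟨a, haD, haU⟩ := U.exists_mem_dense hdev hD
      obtain ⟨z, hz, z₁, hz₁, z₂, hz₂, h⟩ := hR.exists_three_cone_points hrec hdev hq hU hnd
      exact ⟨(⟨a, haD⟩, ⟨z, hcone hz⟩, ⟨z₁, hcone hz₁⟩, ⟨z₂, hcone hz₂⟩), haU, h⟩
    · rintro U - V - k ⟨haU, hU⟩ ⟨haV, hV⟩
      exact LiftedSubconic.ext_carrier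
        (U.convex.eq_of_image_eq V.convex hdev haU haV (hU.trans hV.symm))
  refine (hA.union hB).mono fun U hR => ?_
  obtain ⟨q, hq, hU⟩ := U.isSubconic
  by_cases hdef : ∀ v ≠ 0, 0 < q (dirVec v)
  · exact Or.inl ⟨hR, q, hU, hdef⟩
  · exact Or.inr ⟨hR, q, hq, hU, hdef⟩

end Countable

/-! ### Descent to the quotient -/

section Main

theorem subconicStratum_five_eq {X Z : Type*} [TopologicalSpace X] [ChartedSpace Plane X]
    (π : X → Z) (dev : X → Plane) :
    subconicStratum π dev 5 = Quotient.mk (deckSetoid π dev) '' {U | U.IsRich} := by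
  ext u
  exact ⟨fun ⟨U, hU, hR⟩ => ⟨U, hR, hU⟩, fun ⟨U, hR, hU⟩ => ⟨U, hU, hR⟩⟩

variable {X Z : Type*} [TopologicalSpace X] [ChartedSpace Plane X] [TranslationSurface X]
  [TopologicalSpace Z] [ChartedSpace Plane Z] {dev : X → Plane} {π : X → Z}

/-- The image of an isolating neighbourhood is open. Richness is invariant under covering
transformations, so a class of the stratum in this image is represented by a rich member of the
neighbourhood, which is `U`. -/
theorem isDiscrete_subconicStratum_five (hrec : HasRecurrence dev) (hdev : IsDevelopingMap dev)
    (hF : IsDiscrete (surfaceFrontier X)) (hπ : IsTranslationMap π) :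
    IsDiscrete (subconicStratum π dev 5) := by
  rw [isDiscrete_iff_forall_mem_exists_isOpen, subconicStratum_five_eq]
  rintro _ ⟨U, hR, rfl⟩
  obtain ⟨O, hO, hUO, hiso⟩ := LiftedSubconic.IsRich.exists_isolating hR hrec hdev hF
  refine ⟨_, isOpenMap_mk_deckSetoid hπ hdev O hO, ?_⟩
  refine Subset.antisymm ?_ (singleton_subset_iff.2 ⟨mem_image_of_mem _ hUO, mem_image_of_mem _ hR⟩)
  rintro _ ⟨⟨V, hVO, rfl⟩, W, hW, hWV⟩
  obtain ⟨φ, hφ, hφW⟩ := Quotient.exact hWV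
  obtain ⟨w, hw⟩ := hdev.exists_isDevShift hπ hφ
  rw [mem_singleton_iff, hiso V hVO (LiftedSubconic.IsRich.of_image_eq hW hw hdev hφW)]

end Main

end

theorem mainTheorem6
    {Y X Xt : Type*}
    [TopologicalSpace Y] [ChartedSpace Plane Y] [TranslationSurface Y]
    [TopologicalSpace X] [ChartedSpace Plane X] [TranslationSurface X]
    [TopologicalSpace Xt] [ChartedSpace Plane Xt] [TranslationSurface Xt]
    [SimplyConnectedSpace Xt]
    (hYprecompact : IsPrecompactSurface Y)
    (hYnonempty : (surfaceFrontier Y).Nonempty)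
    (hYfinite : (surfaceFrontier Y).Finite)
    (hXtdiscrete : IsDiscrete (surfaceFrontier Xt))
    (p : X → Y) (hp : IsCoveringMap p) (hpt : IsTranslationMap p)
    (π : Xt → X) (hπ : IsCoveringMap π) (hπt : IsTranslationMap π)
    (dev : Xt → Plane) (hdev : IsDevelopingMap dev) :
    IsDiscrete (subconicStratum π dev 5) ∧ (subconicStratum π dev 5).Countable := by
  have hrec : HasRecurrence dev := fun u ε hε =>
    exists_recurrence hYprecompact hp hpt hπ hπt hdev u hε
  refine ⟨isDiscrete_subconicStratum_five hrec hdev hXtdiscrete hπt, ?_⟩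
  rw [subconicStratum_five_eq]
  exact (countable_setOf_isRich hrec hdev hXtdiscrete).image _
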